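/- Throughout, the base field is $\mathbb{C}$ and all spaces are $\mathbb{Z}/2$-graded (superspaces); $p(a,b)=(-1)^{p(a)p(b)}$ for elements $a,b$ of parities $p(a),p(b)$. Let $\Gamma$ be a subgroup of $(\mathbb{R},+)$ containing $\mathbb{Z}$, and let $V$ be a $\Gamma/\mathbb{Z}$-graded vertex algebra with energy operator $H$: $V=\bigoplus_{[\alpha]\in\Gamma/\mathbb{Z}}V^{[\alpha]}$ is a vertex superalgebra with vacuum $|0\rangle\in V^{[0]}$, state-field correspondence $Y(a,z)=\sum_{n\in\mathbb{Z}}a_{(n)}z^{-n-1}$ (injective in $a$) satisfying the vacuum axiom and the Borcherds identity, each $V^{[\alpha]}$ is a sub-superspace, $V^{[\alpha]}{}_{(n)}V^{[\beta]}\subseteq V^{[\alpha]+[\beta]}$, and $H$ is an even diagonalizable operator on $V$ with real (not necessarily integral) eigenvalues such that $H(V^{[\alpha]})\subseteq V^{[\alpha]}$ and $[H,Y(a,z)]=z\partial_zY(a,z)+Y(Ha,z)$. Put $Ta=a_{(-2)}|0\rangle$. For $a\in V^{[\gamma]}$ with $Ha=\Delta_a a$ let $\epsilon_a\in(-1,0]$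 be the largest non-positive element of the coset $[\epsilon_a]=[\gamma]-[\Delta_a]$ of $\mathbb{Z}$ in $\mathbb{R}$, and put $\gamma_a=\Delta_a+\epsilon_a$. Let $\chi(a,b)=1$ if $\epsilon_a+\epsilon_b\le-1$ and $\chi(a,b)=0$ otherwise. Formulas in $\gamma_a$, $\epsilon_a$, $\Delta_a$ are stated for homogeneous elements and extended linearly. Let $V_\Gamma\subseteq V$ be the span of the homogeneous $a$ with $[\epsilon_a]=[0]$, and $V_{\Gamma,\hbar}=\mathbb{C}[\hbar,\hbar^{-1}]\otimes_{\mathbb{C}}V_\Gamma$. Fix an integer $p\ge0$. For $a,b\in V$ and $n\in\mathbb{Z}$ put $$a_{[n]}b=\sum_{j\ge0}\binom{\gamma_a+p}{j}\hbar^ja_{(n+j)}b,\qquad [a,b]_\hbar=\sum_{j\ge0}\binom{\gamma_a-1}{j}\hbar^ja_{(j)}b,$$ define on $V_{\Gamma,\hbar}$ the $\mathbb{C}[\hbar,\hbar^{-1}]$-bilinear product given for $a,b\in V_\Gamma$ by $$a*_pb=\sum_{m=0}^p\binom{-p-1}{m}\hbar^{-p-m}a_{[-p-1-m]}b,$$ and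 let $J=J_{p,\Gamma,\hbar}\subseteq V_{\Gamma,\hbar}$ be the $\mathbb{C}[\hbar,\hbar^{-1}]$-span of all $(T+\hbar H)a$ with $a\in V_\Gamma$ and all $a_{[-2p-2+\chi(a,b)]}b$ with $a,b\in V$ homogeneous and $[\epsilon_a]+[\epsilon_b]=[0]$. Then: 1. $J$ is a ($\mathbb{Z}/2$-graded) two-sided ideal of $(V_{\Gamma,\hbar},*_p)$. 2. (Skew-symmetry formula.) For all $a,b\in V_\Gamma$ homogeneous in parity, $a*_pb-p(a,b)\,b*_pa\equiv\hbar[a,b]_\hbar \pmod J$. 3. The product induced by $*_p$ on the quotient $\mathrm{Zhu}_{p,\Gamma,\hbar}(V)=V_{\Gamma,\hbar}/J$ is well defined and associative, and the class of $|0\rangle$ is a two-sided unit for it (the quotient may be zero). -/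

import Mathlib

open scoped TensorProduct

noncomputable section

/-! ### Vertex superalgebras -/

/-- The `n`-th product `a_(n) b`, the coefficient of `z^(-n-1)` in `Y(a, z) b`. -/
def nthProduct {V : Type*} [AddCommGroup V] [Module ℂ V] (Y : V →ₗ[ℂ] VertexOperator ℂ V)
    (n : ℤ) : V →ₗ[ℂ] V →ₗ[ℂ] V :=
  (LinearMap.proj n : (ℤ → Module.End ℂ V) →ₗ[ℂ] Module.End ℂ V) ∘ₗ VertexOperator.ncoeff ∘ₗ Y

/-- The sign `p(a, b) = (-1)^(p(a) p(b))` for elements `a`, `b` of parities `i`, `j`. -/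
def paritySign (i j : ZMod 2) : ℂ := (-1) ^ (i.val * j.val)

/-- A vertex (super)algebra over `ℂ`. The field `Y` is valued in linear maps
`V → V((z))`, so that `a_(n) b = 0` for `n` large. -/
structure VertexAlgebra (V : Type*) [AddCommGroup V] [Module ℂ V] where
  /-- The even and the odd part of the superspace `V`. -/
  parity : ZMod 2 → Submodule ℂ V
  parity_isInternal : DirectSum.IsInternal parity
  /-- The vacuum vector. -/
  vac : V
  vac_ne_zero : vac ≠ 0
  vac_even : vac ∈ parity 0
  /-- The state-field correspondence. -/
  Y : V →ₗ[ℂ] VertexOperator ℂ V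
  Y_injective : Function.Injective Y
  Y_parity : ∀ (i j : ZMod 2) (a b : V) (n : ℤ), a ∈ parity i → b ∈ parity j →
    nthProduct Y n a b ∈ parity (i + j)
  vacuum : ∀ (n : ℤ) (b : V), nthProduct Y n vac b = if n = -1 then b else 0
  /-- The Borcherds identity, as the equality of the coefficients of `z^(-m-1) w^(-k-1)`.
  All three families are finitely supported in `j`. -/
  borcherds : ∀ (i i' : ZMod 2) (a b c : V) (m k n : ℤ), a ∈ parity i → b ∈ parity i' →
    ∑ᶠ j : ℕ, Ring.choose m j • nthProduct Y (m + k - j) (nthProduct Y (n + j) a b) c =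
    ∑ᶠ j : ℕ, ((-1 : ℤ) ^ j * Ring.choose n j) •
      (nthProduct Y (m + n - j) a (nthProduct Y (k + j) b c)
        - (paritySign i i' * (-1 : ℂ) ^ n) •
          nthProduct Y (k + n - j) b (nthProduct Y (m + j) a c))

namespace VertexAlgebra

variable {V : Type*} [AddCommGroup V] [Module ℂ V] (A : VertexAlgebra V)

/-- The `n`-th product `a_(n) b`. -/
abbrev prod (n : ℤ) : V →ₗ[ℂ] V →ₗ[ℂ] V := nthProduct A.Y n

/-- The translation operator `T a = a_(-2) vac`. -/
def translation : V →ₗ[ℂ] V := (A.prod (-2)).flip A.vac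

theorem prod_eq_zero_of_large (a b : V) : ∃ N : ℤ, ∀ n : ℤ, N ≤ n → A.prod n a b = 0 := by
  refine ⟨-((HahnModule.of ℂ).symm (A.Y a b)).order, fun n hn => ?_⟩
  exact VertexOperator.ncoeff_eq_zero_of_lt_order (A.Y a) n b (by omega)

end VertexAlgebra

/-! ### Gradings by `Γ/ℤ` and energy operators -/

/-- The group `Γ/ℤ` (for a subgroup `Γ` of `ℝ` that contains `ℤ`). -/
abbrev ModInt (Γ : AddSubgroup ℝ) : Type :=
  ↥Γ ⧸ (AddSubgroup.zmultiples (1 : ℝ)).addSubgroupOf Γ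

open scoped Classical in
/-- A `Γ/ℤ`-graded vertex algebra: `V` is the direct sum of sub-superspaces `deg x`, `x ∈ Γ/ℤ`. -/
structure GradedVertexAlgebra (Γ : AddSubgroup ℝ) (V : Type*) [AddCommGroup V] [Module ℂ V]
    extends VertexAlgebra V where
  /-- The space of elements of degree `x`. -/
  deg : ModInt Γ → Submodule ℂ V
  deg_isInternal : DirectSum.IsInternal deg
  deg_super : ∀ x, deg x = ⨆ i : ZMod 2, deg x ⊓ parity i
  vac_deg : vac ∈ deg 0
  prod_deg : ∀ (x y : ModInt Γ) (a b : V) (n : ℤ), a ∈ deg x → b ∈ deg y →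
    nthProduct Y n a b ∈ deg (x + y)

/-- An energy operator: an even operator, diagonalizable with real eigenvalues, that preserves the
degrees and satisfies `[H, Y(a, z)] = z ∂_z Y(a, z) + Y(H a, z)`. -/
structure EnergyOperator {Γ : AddSubgroup ℝ} {V : Type*} [AddCommGroup V] [Module ℂ V]
    (A : GradedVertexAlgebra Γ V) where
  H : Module.End ℂ V
  diagonalizable : ⨆ Δ : ℝ, H.eigenspace (Δ : ℂ) = ⊤
  even : ∀ (i : ZMod 2) (a : V), a ∈ A.parity i → H a ∈ A.parity i
  deg_stable : ∀ (x : ModInt Γ) (a : V), a ∈ A.deg x → H a ∈ A.deg x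
  comm : ∀ (n : ℤ) (a b : V),
    H (A.prod n a b) - A.prod n a (H b) = (-n - 1 : ℂ) • A.prod n a b + A.prod n (H a) b

/-- For an element of degree `x = [γ]` and conformal weight `Δ`, the number `ε`: the largest
non-positive element of the coset `[γ] - [Δ]` of `ℤ` in `ℝ`. -/
def epsilon {Γ : AddSubgroup ℝ} (x : ModInt Γ) (Δ : ℝ) : ℝ :=
  -Int.fract (Δ - ((Quotient.out x : ↥Γ) : ℝ))

/-- `γ = Δ + ε`, the largest element of `[γ]` that does not exceed `Δ`. -/
def gammaIndex {Γ : AddSubgroup ℝ} (x : ModInt Γ) (Δ : ℝ) : ℝ := Δ + epsilon x Δ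

theorem epsilon_mk {Γ : AddSubgroup ℝ} (g : ↥Γ) (Δ : ℝ) :
    epsilon (g : ModInt Γ) Δ = -Int.fract (Δ - (g : ℝ)) := by
  have h : ((Quotient.out (g : ModInt Γ) : ↥Γ) : ModInt Γ) = (g : ModInt Γ) :=
    QuotientAddGroup.out_eq' _
  rw [QuotientAddGroup.eq, AddSubgroup.mem_addSubgroupOf, AddSubgroup.mem_zmultiples_iff] at h
  obtain ⟨n, hn⟩ := h
  unfold epsilon
  congr 1
  rw [Int.fract_eq_fract]
  refine ⟨n, ?_⟩
  push_cast at hn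
  simp only [zsmul_eq_mul, mul_one] at hn
  rw [hn]; ring

theorem epsilon_eq_add_int {Γ : AddSubgroup ℝ} (g : ↥Γ) (Δ : ℝ) :
    ∃ n : ℤ, epsilon (g : ModInt Γ) Δ = (g : ℝ) - Δ + n := by
  rw [epsilon_mk]
  exact ⟨⌊Δ - (g : ℝ)⌋, by rw [Int.fract]; ring⟩

theorem epsilon_nonpos {Γ : AddSubgroup ℝ} (x : ModInt Γ) (Δ : ℝ) : epsilon x Δ ≤ 0 :=
  neg_nonpos.2 (Int.fract_nonneg _)

theorem neg_one_lt_epsilon {Γ : AddSubgroup ℝ} (x : ModInt Γ) (Δ : ℝ) : -1 < epsilon x Δ :=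
  neg_lt_neg (Int.fract_lt_one _)

theorem epsilon_eq_zero {Γ : AddSubgroup ℝ} (x y : ModInt Γ) (Δ Δ' : ℝ) (n : ℤ)
    (h : ∃ m : ℤ, epsilon x Δ + epsilon y Δ' = m) : epsilon (x + y) (Δ + Δ' - n - 1) = 0 := by
  induction x using QuotientAddGroup.induction_on with | H g => ?_
  induction y using QuotientAddGroup.induction_on with | H g' => ?_
  obtain ⟨m, hm⟩ := h
  obtain ⟨u, hu⟩ := epsilon_eq_add_int g Δ
  obtain ⟨v, hv⟩ := epsilon_eq_add_int g' Δ'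
  obtain ⟨w, hw⟩ := epsilon_eq_add_int (g + g') (Δ + Δ' - n - 1)
  have h1 := epsilon_nonpos ((g + g' : ↥Γ) : ModInt Γ) (Δ + Δ' - n - 1)
  have h2 := neg_one_lt_epsilon ((g + g' : ↥Γ) : ModInt Γ) (Δ + Δ' - n - 1)
  rw [← QuotientAddGroup.mk_add]
  have h3 : epsilon ((g + g' : ↥Γ) : ModInt Γ) (Δ + Δ' - n - 1)
      = ((m - u - v + n + 1 + w : ℤ) : ℝ) := by
    rw [hw]; push_cast; rw [← hm, hu, hv]; ring
  rw [h3] at h1 h2 ⊢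
  norm_cast at h1 h2 ⊢
  omega

/-- `χ(a, b)` for `a` of degree `x` and weight `Δ`, and `b` of degree `y` and weight `Δ'`. -/
def chi {Γ : AddSubgroup ℝ} (x : ModInt Γ) (Δ : ℝ) (y : ModInt Γ) (Δ' : ℝ) : ℤ :=
  if epsilon x Δ + epsilon y Δ' ≤ -1 then 1 else 0

/-- The ring `ℂ[ħ, ħ⁻¹]`. -/
abbrev HbarRing : Type := LaurentPolynomial ℂ

/-- `ħ ^ n` for `n : ℤ`. -/
abbrev hbarPow (n : ℤ) : HbarRing := LaurentPolynomial.T n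

/-- The `ℂ[ħ, ħ⁻¹]`-bilinear extension of a `ℂ`-bilinear map. -/
def bilinExtend {V W : Type*} [AddCommGroup V] [Module ℂ V] [AddCommGroup W] [Module ℂ W]
    (f : V →ₗ[ℂ] V →ₗ[ℂ] (HbarRing ⊗[ℂ] W)) :
    (HbarRing ⊗[ℂ] V) →ₗ[HbarRing] (HbarRing ⊗[ℂ] V) →ₗ[HbarRing] (HbarRing ⊗[ℂ] W) :=
  LinearMap.liftBaseChange HbarRing
    (((LinearMap.liftBaseChangeEquiv HbarRing).toLinearMap.restrictScalars ℂ) ∘ₗ f)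

theorem bilinExtend_tmul {V W : Type*} [AddCommGroup V] [Module ℂ V] [AddCommGroup W] [Module ℂ W]
    (f : V →ₗ[ℂ] V →ₗ[ℂ] (HbarRing ⊗[ℂ] W)) (r s : HbarRing) (a b : V) :
    bilinExtend f (r ⊗ₜ a) (s ⊗ₜ b) = (r * s) • f a b := by
  simp [bilinExtend, mul_smul]

namespace VertexAlgebra

variable {V : Type*} [AddCommGroup V] [Module ℂ V] (A : VertexAlgebra V)

theorem residueProd_support (s : ℝ) (n : ℤ) (a b : V) :
    (Function.support fun j : ℕ => (hbarPow j ⊗ₜ[ℂ] (((Ring.choose s j : ℝ) : ℂ) •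
      A.prod (n + j) a b) : HbarRing ⊗[ℂ] V)).Finite := by
  obtain ⟨N, hN⟩ := A.prod_eq_zero_of_large a b
  refine (Set.finite_lt_nat (N - n).toNat).subset fun j hj => ?_
  simp only [Function.mem_support] at hj
  simp only [Set.mem_ofPred_eq]
  by_contra hc
  exact hj (by rw [hN _ (by omega), smul_zero, TensorProduct.tmul_zero])

/-- The coefficient of `z^(-n-1)` in `(1 + ħ z)^s Y(a, z) b`, that is, the finite sum
`∑_{j ≥ 0} binom(s, j) ħ^j a_(n+j) b`. -/
def residueProd (s : ℝ) (n : ℤ) : V →ₗ[ℂ] V →ₗ[ℂ] (HbarRing ⊗[ℂ] V) :=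
  LinearMap.mk₂ ℂ
    (fun a b => ∑ᶠ j : ℕ, hbarPow j ⊗ₜ[ℂ] (((Ring.choose s j : ℝ) : ℂ) • A.prod (n + j) a b))
    (fun a a' b => by
      rw [← finsum_add_distrib (A.residueProd_support s n a b) (A.residueProd_support s n a' b)]
      simp [TensorProduct.tmul_add])
    (fun c a b => by
      rw [smul_finsum' c (A.residueProd_support s n a b)]
      exact finsum_congr fun j => by
        rw [map_smul, LinearMap.smul_apply, smul_comm, TensorProduct.tmul_smul])
    (fun a b b' => by
      rw [← finsum_add_distrib (A.residueProd_support s n a b) (A.residueProd_support s n a b')]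
      simp [TensorProduct.tmul_add])
    (fun c a b => by
      rw [smul_finsum' c (A.residueProd_support s n a b)]
      exact finsum_congr fun j => by rw [map_smul, smul_comm, TensorProduct.tmul_smul])

theorem residueProd_apply (s : ℝ) (n : ℤ) (a b : V) :
    A.residueProd s n a b =
      ∑ᶠ j : ℕ, hbarPow j ⊗ₜ[ℂ] (((Ring.choose s j : ℝ) : ℂ) • A.prod (n + j) a b) := rfl

end VertexAlgebra

namespace EnergyOperator

variable {Γ : AddSubgroup ℝ} {V : Type*} [AddCommGroup V] [Module ℂ V]
  {A : GradedVertexAlgebra Γ V} (E : EnergyOperator A)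

/-- The elements of degree `x` and conformal weight `Δ`. -/
def component (x : ModInt Γ) (Δ : ℝ) : Submodule ℂ V := A.deg x ⊓ E.H.eigenspace (Δ : ℂ)

open scoped Classical in
theorem weight_isInternal : DirectSum.IsInternal fun Δ : ℝ => E.H.eigenspace (Δ : ℂ) :=
  DirectSum.isInternal_submodule_of_iSupIndep_of_iSup_eq_top
    (E.H.eigenspaces_iSupIndep.comp Complex.ofReal_injective) E.diagonalizable

open scoped Classical in
/-- The linear map that agrees with `f x Δ` on the elements of degree `x` and weight `Δ`, for
all `x` and `Δ`: "defined for homogeneous elements and extended linearly". -/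
def extendLinearly {W : Type*} [AddCommMonoid W] [Module ℂ W]
    (f : ModInt Γ → ℝ → V →ₗ[ℂ] W) : V →ₗ[ℂ] W :=
  DirectSum.toModule ℂ (ModInt Γ) W
      (fun x => DirectSum.toModule ℂ ℝ W (fun Δ => f x Δ ∘ₗ (E.H.eigenspace (Δ : ℂ)).subtype) ∘ₗ
        (LinearEquiv.ofBijective (DirectSum.coeLinearMap fun Δ : ℝ => E.H.eigenspace (Δ : ℂ))
          E.weight_isInternal).symm.toLinearMap ∘ₗ (A.deg x).subtype) ∘ₗ
    (LinearEquiv.ofBijective (DirectSum.coeLinearMap A.deg) A.deg_isInternal).symm.toLinearMap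

open scoped Classical in
theorem extendLinearly_apply {W : Type*} [AddCommMonoid W] [Module ℂ W]
    (f : ModInt Γ → ℝ → V →ₗ[ℂ] W) {x : ModInt Γ} {Δ : ℝ} {a : V} (ha : a ∈ E.component x Δ) :
    E.extendLinearly f a = f x Δ a := by
  have h1 : (LinearEquiv.ofBijective (DirectSum.coeLinearMap A.deg) A.deg_isInternal).symm a
      = DirectSum.lof ℂ (ModInt Γ) (fun x => A.deg x) x ⟨a, ha.1⟩ := by
    rw [LinearEquiv.symm_apply_eq]
    exact (DirectSum.coeLinearMap_lof A.deg x ⟨a, ha.1⟩).symm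
  have h2 : (LinearEquiv.ofBijective (DirectSum.coeLinearMap fun Δ : ℝ => E.H.eigenspace (Δ : ℂ))
      E.weight_isInternal).symm a
      = DirectSum.lof ℂ ℝ (fun Δ : ℝ => E.H.eigenspace (Δ : ℂ)) Δ ⟨a, ha.2⟩ := by
    rw [LinearEquiv.symm_apply_eq]
    exact (DirectSum.coeLinearMap_lof (fun Δ : ℝ => E.H.eigenspace (Δ : ℂ)) Δ ⟨a, ha.2⟩).symm
  simp only [extendLinearly, LinearMap.comp_apply, LinearEquiv.coe_coe, h1,
    DirectSum.toModule_lof, Submodule.subtype_apply, h2]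

/-- The product `a_[n, ħ] b`, the coefficient of `z^(-n-1)` in `(1 + ħ z)^(γ_a + p) Y(a, z) b`. -/
def sqProd (p : ℕ) (n : ℤ) : V →ₗ[ℂ] V →ₗ[ℂ] (HbarRing ⊗[ℂ] V) :=
  E.extendLinearly fun x Δ => A.residueProd (gammaIndex x Δ + p) n

/-- The bracket `[a, b]_ħ`, the residue of `(1 + ħ z)^(γ_a - 1) Y(a, z) b`. -/
def bracket : V →ₗ[ℂ] V →ₗ[ℂ] (HbarRing ⊗[ℂ] V) :=
  E.extendLinearly fun x Δ => A.residueProd (gammaIndex x Δ - 1) 0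

/-- `a *_p b = ∑_{m = 0}^p binom(-p-1, m) ħ^(-p-m) a_[-p-1-m, ħ] b` for `a, b ∈ V`. -/
def starBase (p : ℕ) : V →ₗ[ℂ] V →ₗ[ℂ] (HbarRing ⊗[ℂ] V) :=
  ∑ m ∈ Finset.range (p + 1),
    Ring.choose (-(p : ℤ) - 1) m • hbarPow (-(p : ℤ) - m) • E.sqProd p (-(p : ℤ) - 1 - m)

/-- The space `V_Γ`, spanned by the homogeneous elements with `[ε] = [0]`. -/
def VGamma : Submodule ℂ V :=
  ⨆ i : {i : ModInt Γ × ℝ // epsilon i.1 i.2 = 0}, E.component i.1.1 i.1.2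

/-- `V_{Γ, ħ} = ℂ[ħ, ħ⁻¹] ⊗ V_Γ`. -/
abbrev VGammaHbar : Type _ := HbarRing ⊗[ℂ] E.VGamma

/-- The inclusion of `V_{Γ, ħ}` in `ℂ[ħ, ħ⁻¹] ⊗ V`. -/
def toHbar : E.VGammaHbar →ₗ[HbarRing] HbarRing ⊗[ℂ] V := E.VGamma.subtype.baseChange HbarRing

theorem toHbar_tmul (r : HbarRing) (a : E.VGamma) : E.toHbar (r ⊗ₜ a) = r ⊗ₜ (a : V) := rfl

theorem toHbar_injective : Function.Injective E.toHbar :=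
  Module.Flat.lTensor_preserves_injective_linearMap (M := HbarRing) E.VGamma.subtype
    E.VGamma.injective_subtype

theorem tmul_mem_range (r : HbarRing) {a : V} (ha : a ∈ E.VGamma) :
    r ⊗ₜ a ∈ LinearMap.range E.toHbar := ⟨r ⊗ₜ ⟨a, ha⟩, rfl⟩

theorem component_le_VGamma {x : ModInt Γ} {Δ : ℝ} (h : epsilon x Δ = 0) :
    E.component x Δ ≤ E.VGamma :=
  le_iSup (fun i : {i : ModInt Γ × ℝ // epsilon i.1 i.2 = 0} => E.component i.1.1 i.1.2)
    ⟨(x, Δ), h⟩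

theorem VGamma_induction {q : V → Prop}
    (hc : ∀ (x : ModInt Γ) (Δ : ℝ) (a : V), epsilon x Δ = 0 → a ∈ E.component x Δ → q a)
    (h0 : q 0) (hadd : ∀ a b, q a → q b → q (a + b)) {a : V} (ha : a ∈ E.VGamma) : q a :=
  Submodule.iSup_induction _ (motive := q) ha (fun i a hi => hc _ _ a i.2 hi) h0 hadd

theorem prod_mem_component {x y : ModInt Γ} {Δ Δ' : ℝ} {a b : V} (n : ℤ)
    (ha : a ∈ E.component x Δ) (hb : b ∈ E.component y Δ') :
    A.prod n a b ∈ E.component (x + y) (Δ + Δ' - n - 1) := by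
  refine ⟨A.prod_deg x y a b n ha.1 hb.1, ?_⟩
  have h1 := Module.End.mem_eigenspace_iff.1 ha.2
  have h2 := Module.End.mem_eigenspace_iff.1 hb.2
  have h := E.comm n a b
  rw [h1, h2, map_smul, map_smul, LinearMap.smul_apply, sub_eq_iff_eq_add] at h
  rw [SetLike.mem_coe, Module.End.mem_eigenspace_iff, h]
  push_cast
  module

theorem sqProd_mem {x y : ModInt Γ} {Δ Δ' : ℝ} {a b : V} (p : ℕ) (n : ℤ)
    (ha : a ∈ E.component x Δ) (hb : b ∈ E.component y Δ')
    (h : ∃ m : ℤ, epsilon x Δ + epsilon y Δ' = m) : E.sqProd p n a b ∈ LinearMap.range E.toHbar := by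
  rw [sqProd, E.extendLinearly_apply _ ha, VertexAlgebra.residueProd_apply]
  refine finsum_induction (· ∈ LinearMap.range E.toHbar) (zero_mem _) (fun _ _ => add_mem) fun j => ?_
  exact E.tmul_mem_range _ (Submodule.smul_mem _ _
    (E.component_le_VGamma (epsilon_eq_zero x y Δ Δ' _ h) (E.prod_mem_component _ ha hb)))

theorem starBase_mem (p : ℕ) {a b : V} (ha : a ∈ E.VGamma) (hb : b ∈ E.VGamma) :
    E.starBase p a b ∈ LinearMap.range E.toHbar := by
  refine E.VGamma_induction (q := fun a => E.starBase p a b ∈ LinearMap.range E.toHbar) ?_ (by simp)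
    (fun a a' h h' => by rw [map_add, LinearMap.add_apply]; exact add_mem h h') ha
  intro x Δ a hx ha
  refine E.VGamma_induction (q := fun b => E.starBase p a b ∈ LinearMap.range E.toHbar) ?_ (by simp)
    (fun b b' h h' => by rw [map_add]; exact add_mem h h') hb
  intro y Δ' b hy hb
  simp only [starBase, LinearMap.sum_apply, LinearMap.smul_apply]
  exact sum_mem fun m _ => zsmul_mem (Submodule.smul_mem _ _
    (E.sqProd_mem p _ ha hb ⟨0, by rw [hx, hy]; simp⟩)) _

theorem bilinExtend_starBase_mem (p : ℕ) (x y : E.VGammaHbar) :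
    bilinExtend (E.starBase p) (E.toHbar x) (E.toHbar y) ∈ LinearMap.range E.toHbar := by
  induction x using TensorProduct.induction_on with
  | zero => simp
  | add u v hu hv => rw [map_add, map_add, LinearMap.add_apply]; exact add_mem hu hv
  | tmul r a =>
    induction y using TensorProduct.induction_on with
    | zero => simp
    | add u v hu hv => rw [map_add, map_add]; exact add_mem hu hv
    | tmul s b =>
      rw [toHbar_tmul, toHbar_tmul, bilinExtend_tmul]
      exact Submodule.smul_mem _ _ (E.starBase_mem p a.2 b.2)

/-- The unique element of `V_{Γ, ħ}` whose image in `ℂ[ħ, ħ⁻¹] ⊗ V` is `x *_p y`. -/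
def starFun (p : ℕ) (x y : E.VGammaHbar) : E.VGammaHbar :=
  (E.bilinExtend_starBase_mem p x y).choose

theorem toHbar_starFun (p : ℕ) (x y : E.VGammaHbar) :
    E.toHbar (E.starFun p x y) = bilinExtend (E.starBase p) (E.toHbar x) (E.toHbar y) :=
  (E.bilinExtend_starBase_mem p x y).choose_spec

/-- The `ℂ[ħ, ħ⁻¹]`-bilinear product `*_p` on `V_{Γ, ħ}`. -/
def star (p : ℕ) : E.VGammaHbar →ₗ[HbarRing] E.VGammaHbar →ₗ[HbarRing] E.VGammaHbar :=
  LinearMap.mk₂ HbarRing (E.starFun p)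
    (fun x x' y => E.toHbar_injective (by simp [toHbar_starFun]))
    (fun r x y => E.toHbar_injective (by simp [toHbar_starFun]))
    (fun x y y' => E.toHbar_injective (by simp [toHbar_starFun]))
    (fun r x y => E.toHbar_injective (by simp [toHbar_starFun]))

theorem toHbar_star (p : ℕ) (x y : E.VGammaHbar) :
    E.toHbar (E.star p x y) = bilinExtend (E.starBase p) (E.toHbar x) (E.toHbar y) :=
  E.toHbar_starFun p x y

theorem vac_mem_component : A.vac ∈ E.component 0 0 := by
  have hv : E.H A.vac = 0 := by
    refine A.Y_injective ?_
    rw [map_zero]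
    ext b n
    have h := E.comm (-n - 1) A.vac b
    have h0 : A.prod (-n - 1) (E.H A.vac) b = 0 := by
      simp only [VertexAlgebra.prod, A.vacuum] at h
      by_cases hn : -n - 1 = -1
      · have : n = 0 := by omega
        subst this
        simpa using h.symm
      · simpa [hn] using h.symm
    have h2 : ((HahnModule.of ℂ).symm (A.Y (E.H A.vac) b)).coeff (-(-n - 1) - 1) = 0 := h0
    rw [show -(-n - 1) - 1 = n by ring] at h2
    simpa using h2
  refine ⟨A.vac_deg, ?_⟩
  rw [SetLike.mem_coe, Module.End.mem_eigenspace_iff, hv]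
  simp

theorem epsilon_zero : epsilon (0 : ModInt Γ) 0 = 0 := by
  simpa using epsilon_mk (0 : ↥Γ) 0

theorem vac_mem_VGamma : A.vac ∈ E.VGamma :=
  E.component_le_VGamma epsilon_zero E.vac_mem_component

/-- The vacuum as an element of `V_{Γ, ħ}`. -/
def vacuum : E.VGammaHbar := 1 ⊗ₜ ⟨A.vac, E.vac_mem_VGamma⟩

/-- The elements `(T + ħ H) a`, `a ∈ V_Γ`. -/
def jGenerators₁ : Set (HbarRing ⊗[ℂ] V) :=
  {u | ∃ a ∈ E.VGamma, u = 1 ⊗ₜ A.translation a + hbarPow 1 ⊗ₜ E.H a}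

/-- The elements `a_[-2p-2+χ(a,b), ħ] b`, for homogeneous `a`, `b` with `[ε_a] + [ε_b] = [0]`. -/
def jGenerators₂ (p : ℕ) : Set (HbarRing ⊗[ℂ] V) :=
  {u | ∃ (x y : ModInt Γ) (Δ Δ' : ℝ) (a b : V),
    a ∈ E.component x Δ ∧ b ∈ E.component y Δ' ∧
    (∃ m : ℤ, epsilon x Δ + epsilon y Δ' = m) ∧
    u = E.sqProd p (-2 * (p : ℤ) - 2 + chi x Δ y Δ') a b}

theorem jGenerators_subset (p : ℕ) : E.jGenerators₁ ∪ E.jGenerators₂ p ⊆ LinearMap.range E.toHbar := by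
  rintro u (⟨a, ha, rfl⟩ | ⟨x, y, Δ, Δ', a, b, ha, hb, h, rfl⟩)
  · refine add_mem (E.tmul_mem_range _ ?_)
      (E.tmul_mem_range _ ?_)
    · refine E.VGamma_induction (q := fun a => A.translation a ∈ E.VGamma) ?_ (by simp)
        (fun a b h h' => by rw [map_add]; exact add_mem h h') ha
      intro x Δ a hx ha
      exact E.component_le_VGamma
        (epsilon_eq_zero x 0 Δ 0 (-2) ⟨0, by rw [hx, epsilon_zero]; simp⟩)
        (E.prod_mem_component (-2) ha E.vac_mem_component)
    · refine E.VGamma_induction (q := fun a => E.H a ∈ E.VGamma) ?_ (by simp)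
        (fun a b h h' => by rw [map_add]; exact add_mem h h') ha
      intro x Δ a hx ha
      rw [Module.End.mem_eigenspace_iff.1 ha.2]
      exact Submodule.smul_mem _ _ (E.component_le_VGamma hx ha)
  · exact E.sqProd_mem p _ ha hb h

/-- The subspace `J_{p, Γ, ħ}` of `V_{Γ, ħ}`, the `ℂ[ħ, ħ⁻¹]`-span of all these elements
(which lie in `V_{Γ, ħ}` by `jGenerators_subset`). -/
def J (p : ℕ) : Submodule HbarRing E.VGammaHbar :=
  (Submodule.span HbarRing (E.jGenerators₁ ∪ E.jGenerators₂ p)).comap E.toHbar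

/-- The even (`i = 0`) and the odd (`i = 1`) part of `V_{Γ, ħ}`. -/
def parityHbar (i : ZMod 2) : Submodule HbarRing E.VGammaHbar :=
  ((A.parity i).baseChange HbarRing).comap E.toHbar

/-- The quotient module `Zhu_{p, Γ, ħ}(V) = V_{Γ, ħ} / J_{p, Γ, ħ}`. -/
abbrev Zhu (p : ℕ) : Type _ := E.VGammaHbar ⧸ E.J p

end EnergyOperator

end

noncomputable section

/-! ### Binomial series -/

open PowerSeries Finset

/-! Replacing the modes `a_(n)` by `ħ^(n+1) a_(n)` absorbs every power of `ħ`, so the problem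
becomes one about a vertex algebra over `ℂ[ħ, ħ⁻¹]` with `ħ = 1` (`modeAlgebra`). All operations are
then residues of `z^n (1+z)^s Y(a,z) b`, and `J` is the span of the rescaled generators
(`span_jGenerators`). Left multiplication `L_a` by `a` of weight `Δ` with `ε_a = 0` has kernel `∑
binom(-p-1, m) z^(-p-1-m) (1+z)^(Δ+p)`.

Three facts carry the argument. Integration by parts against `T a` shows that `J` contains all
residues with more poles than its generators, even with some extra powers of `1+z`
(`res_mem_ideal`). Since `T ≡ -H` modulo `J`, skew-symmetry becomes the substitution `z ↦ -z/(1+z)`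
(`res_swap`); hence `a * b ≡ ± R_b a`, where `R_b` is again a residue operator in `b`, and the
polynomial identity `sum_choose_mul_pow` gives `L_b - R_b = [b, ·]` exactly. Finally, the commutator
of two residue operators is a combination of residues whose kernels are Hasse derivatives, and when
the two kernels together have enough poles it lands in `J` (`res_commutator_mem_ideal`).

The skew-symmetry formula follows from `a * b ≡ ± R_b a` and `L_b - R_b = [b, ·]`. The operators
`L_u` and `[u, ·]` preserve `J` by the commutator estimate on the residue generators, and by direct
computation together with the swap on the generators `(T + H) v`. The right ideal property follows
because `w * u ≡ ± R_u w = ± (L_u w - [u, w])`. Associativity is the statement that `L_a` and `R_c`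
commute modulo `J` up to sign. The vacuum is an exact left unit, and skew-symmetry makes it a right
unit modulo `J`. -/

theorem Ring.succ_mul_choose_succ (r : ℝ) (n : ℕ) :
    ((n : ℝ) + 1) * Ring.choose r (n + 1) = (r - n) * Ring.choose r n := by
  have h := Ring.choose_smul_choose r (Nat.le_succ n)
  rw [Nat.choose_succ_self_right, show n + 1 - n = 1 by omega, Ring.choose_one_right,
    nsmul_eq_mul] at h
  push_cast at h
  linarith

theorem Ring.choose_succ_mul (r : ℝ) (n : ℕ) :
    ((n : ℝ) + 1) * Ring.choose r (n + 1) = r * Ring.choose (r - 1) n := by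
  have h := Ring.choose_smul_choose r (Nat.le_add_left 1 n)
  rw [Nat.choose_one_right, Nat.add_sub_cancel, Ring.choose_one_right, nsmul_eq_mul] at h
  push_cast at h
  exact h

theorem Ring.neg_one_pow_mul_choose (x : ℝ) (n : ℕ) :
    (-1) ^ n * Ring.choose x n = Ring.choose ((n : ℝ) - x - 1) n := by
  have h := Ring.choose_neg (-x) n
  rw [neg_neg, show -x + n - 1 = (n : ℝ) - x - 1 by ring, Units.smul_def, zsmul_eq_mul] at h
  rw [h, ← mul_assoc]
  have h1 : ((-1 : ℝ) ^ n) * (-1) ^ n = 1 := by rw [← mul_pow]; simp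
  push_cast [Int.coe_negOnePow_natCast]
  rw [h1, one_mul]

/-- `∑ (-1)^i binom(s, i) binom(x - i, l - i) = binom(x - s, l)`. -/
theorem Ring.sum_neg_one_pow_mul_choose (s x : ℝ) (l : ℕ) :
    ∑ ij ∈ antidiagonal l, (-1) ^ ij.1 * Ring.choose s ij.1 * Ring.choose (x - ij.1) ij.2 =
      Ring.choose (x - s) l := by
  have h := Ring.neg_one_pow_mul_choose (x - s) l
  rw [show (l : ℝ) - (x - s) - 1 = s + (l - x - 1) by ring,
    Ring.add_choose_eq l (Commute.all _ _)] at h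
  have h2 : ((-1 : ℝ) ^ l) * (-1) ^ l = 1 := by rw [← mul_pow]; simp
  have h6 : Ring.choose (x - s) l = (-1) ^ l * ((-1) ^ l * Ring.choose (x - s) l) := by
    rw [← mul_assoc, h2, one_mul]
  rw [h6, h, mul_sum]
  refine sum_congr rfl fun ij hij => ?_
  have hl := mem_antidiagonal.1 hij
  have h3 := Ring.neg_one_pow_mul_choose (x - ij.1) ij.2
  rw [show (ij.2 : ℝ) - (x - ij.1) - 1 = l - x - 1 by rw [← hl]; push_cast; ring] at h3
  have h4 : ((-1 : ℝ) ^ ij.2) * (-1) ^ ij.2 = 1 := by rw [← mul_pow]; simp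
  have h5 : (-1 : ℝ) ^ l = (-1) ^ ij.1 * (-1) ^ ij.2 := by rw [← hl, pow_add]
  rw [← h3, h5]
  linear_combination (-(-1) ^ ij.1 * Ring.choose s ij.1 * Ring.choose (x - ij.1) ij.2) * h4

/-- Pascal's rule gives this recursion in `p` for the truncated binomial sum. The error term is
proportional to `t - 2a`: for `t = a + b`, the errors of this relation and of its counterpart with
`b` in place of `a` cancel, which is the induction step of `sum_choose_mul_pow`. -/
theorem sub_mul_sum_choose_mul_pow {S : Type*} [CommRing S] (a t : S) (p : ℕ) :
    (t - a) * ∑ m ∈ range (p + 2), ((p + 1 + m).choose m : S) * a ^ m * t ^ (p + 1 - m) =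
      t ^ 2 * ∑ m ∈ range (p + 1), ((p + m).choose m : S) * a ^ m * t ^ (p - m) +
        ((2 * p + 1).choose (p + 1) : S) * a ^ (p + 1) * (t - 2 * a) := by
  set F := ∑ m ∈ range (p + 2), ((p + 1 + m).choose m : S) * a ^ m * t ^ (p + 1 - m) with hF
  set G := ∑ m ∈ range (p + 1), ((p + m).choose m : S) * a ^ m * t ^ (p - m) with hG
  have h1 : t * ∑ m ∈ range (p + 1), ((p + 1 + m).choose m : S) * a ^ m * t ^ (p - m) =
      F - 2 * ((2 * p + 1).choose (p + 1) : S) * a ^ (p + 1) := by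
    rw [hF, sum_range_succ _ (p + 1), Nat.sub_self, mul_sum]
    have hc : (p + 1 + (p + 1)).choose (p + 1) = 2 * (2 * p + 1).choose (p + 1) := by
      rw [show p + 1 + (p + 1) = (2 * p + 1) + 1 by ring, Nat.choose_succ_succ,
        ← Nat.choose_symm_half p]
      ring
    rw [hc]
    have : ∀ m ∈ range (p + 1), t * (((p + 1 + m).choose m : S) * a ^ m * t ^ (p - m)) =
        ((p + 1 + m).choose m : S) * a ^ m * t ^ (p + 1 - m) := fun m hm => by
      rw [show p + 1 - m = p - m + 1 by have := mem_range.1 hm; omega]; ring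
    rw [sum_congr rfl this]
    push_cast
    ring
  have h2 : ∑ m ∈ range (p + 1), ((p + 1 + m).choose (m + 1) : S) * a ^ (m + 1) * t ^ (p - m)
      + t ^ (p + 1) = t * G + ((2 * p + 1).choose (p + 1) : S) * a ^ (p + 1) := by
    have h3 : ∑ m ∈ range (p + 2), ((p + m).choose m : S) * a ^ m * t ^ (p + 1 - m) =
        t * G + ((2 * p + 1).choose (p + 1) : S) * a ^ (p + 1) := by
      rw [sum_range_succ, hG, mul_sum, Nat.sub_self, pow_zero, mul_one,
        show p + (p + 1) = 2 * p + 1 by ring]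
      congr 1
      refine sum_congr rfl fun m hm => ?_
      rw [show p + 1 - m = p - m + 1 by have := mem_range.1 hm; omega]; ring
    rw [← h3, sum_range_succ' _ (p + 1)]
    simp [add_comm, add_left_comm]
  have h4 : F = a * ∑ m ∈ range (p + 1), ((p + 1 + m).choose m : S) * a ^ m * t ^ (p - m) +
      (∑ m ∈ range (p + 1), ((p + 1 + m).choose (m + 1) : S) * a ^ (m + 1) * t ^ (p - m)
        + t ^ (p + 1)) := by
    rw [hF, sum_range_succ' _ (p + 1), ← add_assoc, mul_sum, ← sum_add_distrib]
    simp only [Nat.choose_zero_right, Nat.cast_one, pow_zero, one_mul, Nat.sub_zero]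
    congr 1
    refine sum_congr rfl fun m _ => ?_
    rw [show p + 1 + (m + 1) = p + 1 + m + 1 by ring, Nat.choose_succ_succ, Nat.add_sub_add_right]
    push_cast
    ring
  rw [h2] at h4
  linear_combination t * h4 + a * h1

/-- The binomial identity behind the product `*_p`. -/
theorem sum_choose_mul_pow {S : Type*} [CommRing S] (a b : S) (p : ℕ) :
    b ^ (p + 1) * ∑ m ∈ range (p + 1), ((p + m).choose m : S) * a ^ m * (a + b) ^ (p - m) +
      a ^ (p + 1) * ∑ m ∈ range (p + 1), ((p + m).choose m : S) * b ^ m * (a + b) ^ (p - m) =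
      (a + b) ^ (2 * p + 1) := by
  induction p with
  | zero => simp; ring
  | succ p ih =>
    have h1 := sub_mul_sum_choose_mul_pow a (a + b) p
    have h2 := sub_mul_sum_choose_mul_pow b (a + b) p
    rw [add_sub_cancel_left] at h1
    rw [add_sub_cancel_right] at h2
    linear_combination b ^ (p + 1) * h1 + a ^ (p + 1) * h2 + (a + b) ^ 2 * ih

/-! ### Hasse derivatives of binomial series. -/

namespace PowerSeries

variable (R : Type*) [CommRing R] [Algebra ℝ R]

/-- The Hasse derivative of order `l` of `z ^ m f(z)`, divided by `z ^ (m - l)`. -/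
def hasseShift {R : Type*} [CommRing R] (m : ℤ) (l : ℕ) (f : R⟦X⟧) : R⟦X⟧ :=
  mk fun i => ((Ring.choose (m + i) l : ℤ) : R) * coeff i f

/-- This is the Leibniz rule for the `l`-th Hasse derivative of `z^m (1+z)^s`. On coefficients it is
Vandermonde for `binom(m+q, l)` combined with `binom(s, q) binom(q, i) = binom(s, i) binom(s-i,
q-i)`. -/
theorem hasseShift_binomialSeries (s : ℝ) (m : ℤ) (l : ℕ) :
    hasseShift m l (binomialSeries R s) = ∑ ij ∈ antidiagonal l,
      ((algebraMap ℝ R (Ring.choose s ij.1)) * ((Ring.choose m ij.2 : ℤ) : R)) •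
        (X ^ ij.1 * binomialSeries R (s - ij.1)) := by
  ext q
  simp only [hasseShift, coeff_mk, binomialSeries_coeff, map_sum, coeff_smul, coeff_X_pow_mul']
  rw [add_comm m, Ring.add_choose_eq l (Commute.all _ _)]
  push_cast
  rw [sum_mul]
  refine sum_congr rfl fun ij _ => ?_
  rw [Ring.choose_natCast]
  split_ifs with h
  · have := Ring.choose_smul_choose s h
    rw [nsmul_eq_mul] at this
    have h2 := congrArg (algebraMap ℝ R) this
    rw [map_mul, map_mul, map_natCast] at h2
    simp only [Algebra.smul_def, mul_one]
    push_cast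
    linear_combination ((Ring.choose m ij.2 : ℤ) : R) * h2
  · rw [Nat.choose_eq_zero_of_lt (not_le.1 h)]
    simp

theorem binomialSeries_add_one (s : ℝ) :
    binomialSeries R (s + 1) = binomialSeries R s + X * binomialSeries R s := by
  have h := binomialSeries_nat (R := ℝ) (A := R) 1
  rw [Nat.cast_one, pow_one] at h
  rw [binomialSeries_add, h]
  ring

end PowerSeries
end

noncomputable section

open PowerSeries Finset

/-! ### Indices `ε` -/

section Epsilon

variable {Γ : AddSubgroup ℝ}

theorem epsilon_add_intCast (x : ModInt Γ) (Δ : ℝ) (n : ℤ) : epsilon x (Δ + n) = epsilon x Δ := by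
  unfold epsilon
  rw [add_sub_right_comm, Int.fract_add_intCast]

/-- A product with an element having `ε = 0` keeps the `ε` of the other factor. Hence `χ` and the
condition `[ε_a] + [ε_b] = [0]` do not change when such an element acts on a generator of `J`. -/
theorem epsilon_add_left {x : ModInt Γ} {Δ : ℝ} (h : epsilon x Δ = 0) (y : ModInt Γ) (Δ' : ℝ)
    (n : ℤ) : epsilon (x + y) (Δ + Δ' - n - 1) = epsilon y Δ' := by
  induction x using QuotientAddGroup.induction_on with | H g => ?_
  induction y using QuotientAddGroup.induction_on with | H g' => ?_
  rw [epsilon_mk, neg_eq_zero] at h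
  rw [← QuotientAddGroup.mk_add, epsilon_mk, epsilon_mk, neg_inj, Int.fract_eq_fract]
  refine ⟨⌊Δ - (g : ℝ)⌋ - n - 1, ?_⟩
  have := Int.floor_add_fract (Δ - (g : ℝ))
  push_cast
  linarith

theorem epsilon_add_eq_zero {x y : ModInt Γ} {Δ Δ' : ℝ} (h : epsilon x Δ = 0)
    (h' : epsilon y Δ' = 0) : epsilon (x + y) (Δ + Δ') = 0 := by
  have := epsilon_add_left h y Δ' (-1)
  rw [h'] at this
  rw [← this]
  push_cast
  ring_nf

end Epsilon

/-- The sign `(-1)^(i j)` as an integer. -/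
def koszulSign (i j : ZMod 2) : ℤ := (-1) ^ (i.val * j.val)

theorem koszulSign_mul_self (i j : ZMod 2) : koszulSign i j * koszulSign i j = 1 := by
  rw [koszulSign, ← mul_pow]; simp

theorem koszulSign_comm (i j : ZMod 2) : koszulSign i j = koszulSign j i := by
  rw [koszulSign, koszulSign, mul_comm]

theorem koszulSign_add_left (i j k : ZMod 2) :
    koszulSign (i + j) k = koszulSign i k * koszulSign j k := by
  revert i j k; decide

theorem koszulSign_zero_left (i : ZMod 2) : koszulSign 0 i = 1 := by
  simp [koszulSign]

/-! ### Residues -/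

theorem sum_antidiagonal_smul {R M : Type*} [CommRing R] [AddCommGroup M] [Module R M] {N : ℕ}
    {v : ℕ → M} (hv : ∀ q, N ≤ q → v q = 0) (φ : ℕ → ℕ → R) :
    ∑ q ∈ range N, (∑ ij ∈ antidiagonal q, φ ij.1 ij.2) • v q =
      ∑ i ∈ range N, ∑ j ∈ range N, φ i j • v (i + j) := by
  rw [← sum_product', ← sum_filter_add_sum_filter_not (range N ×ˢ range N) (fun ij => ij.1 + ij.2 < N)]
  rw [sum_eq_zero (s := (range N ×ˢ range N).filter (fun ij => ¬ (ij.1 + ij.2 < N)))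
    (fun ij h => by rw [hv _ (not_lt.1 (mem_filter.1 h).2), smul_zero]), add_zero,
    ← sum_fiberwise_of_maps_to (t := range N) (g := fun ij : ℕ × ℕ => ij.1 + ij.2)
      (fun ij h => mem_range.2 (mem_filter.1 h).2)]
  refine sum_congr rfl fun q hq => ?_
  rw [sum_smul]
  have hq := mem_range.1 hq
  refine sum_congr ?_ fun ij h => by rw [(mem_filter.1 h).2]
  ext ij
  simp only [HasAntidiagonal.mem_antidiagonal, mem_filter, mem_product, mem_range]
  omega

/-- A module with `n`-th products, homogeneous elements and a vacuum, subject to the commutator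
formula, skew-symmetry and the translation formula. -/
structure ModeAlgebra (Γ : AddSubgroup ℝ) (R M : Type*) [CommRing R] [Algebra ℝ R]
    [AddCommGroup M] [Module R M] where
  mode : ℤ → M →ₗ[R] M →ₗ[R] M
  mode_large : ∀ a b : M, ∃ N : ℤ, ∀ n, N ≤ n → mode n a b = 0
  /-- The homogeneous elements of given parity, degree and conformal weight. -/
  Homog : ZMod 2 → ModInt Γ → ℝ → M → Prop
  mode_homog : ∀ {i j x y Δ Δ' a b} (n : ℤ), Homog i x Δ a → Homog j y Δ' b →
    Homog (i + j) (x + y) (Δ + Δ' - n - 1) (mode n a b)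
  vac : M
  vac_homog : Homog 0 0 0 vac
  vac_mode : ∀ (n : ℤ) (b : M), mode n vac b = if n = -1 then b else 0
  mode_vac : ∀ (n : ℤ) (a : M), 0 ≤ n → mode n a vac = 0
  creation : ∀ a : M, mode (-1) a vac = a
  commutator : ∀ {i j k x y z Δ Δ' Δ'' a b c} (m n : ℤ),
    Homog i x Δ a → Homog j y Δ' b → Homog k z Δ'' c →
    mode m a (mode n b c) - koszulSign i j • mode n b (mode m a c) =
      ∑ᶠ l : ℕ, Ring.choose m l • mode (m + n - l) (mode l a b) c
  skew : ∀ {i j x y Δ Δ' a b} (n : ℤ), Homog i x Δ a → Homog j y Δ' b →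
    ∑ᶠ l : ℕ, (-1 : ℤ) ^ l • mode (-1 - l) (mode (n + l) a b) vac =
      -((koszulSign i j * n.negOnePow) • mode n b a)
  translation : ∀ (n : ℤ) (a b : M), mode n (mode (-2) a vac) b = (-n) • mode (n - 1) a b

namespace ModeAlgebra

variable {Γ : AddSubgroup ℝ} {R M : Type*} [CommRing R] [Algebra ℝ R] [AddCommGroup M] [Module R M]
  (D : ModeAlgebra Γ R M)

theorem exists_bound (n : ℤ) (a b : M) : ∃ N : ℕ, ∀ j : ℕ, N ≤ j → D.mode (n + j) a b = 0 := by
  obtain ⟨N, hN⟩ := D.mode_large a b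
  exact ⟨(N - n).toNat, fun j hj => hN _ (by omega)⟩

theorem support_finite (n : ℤ) (f : R⟦X⟧) (a b : M) :
    (Function.support fun j : ℕ => coeff j f • D.mode (n + j) a b).Finite := by
  obtain ⟨N, hN⟩ := D.exists_bound n a b
  refine (Set.finite_lt_nat N).subset fun j hj => ?_
  by_contra hc
  exact hj (by simp only [hN j (not_lt.1 hc), smul_zero])

/-- The residue of `z ^ n f(z) Y(a, z) b`. -/
def res (n : ℤ) : R⟦X⟧ →ₗ[R] M →ₗ[R] M →ₗ[R] M where
  toFun f := LinearMap.mk₂ R (fun a b => ∑ᶠ j : ℕ, coeff j f • D.mode (n + j) a b)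
    (fun a a' b => by
      rw [← finsum_add_distrib (D.support_finite n f a b) (D.support_finite n f a' b)]
      simp)
    (fun r a b => by
      rw [smul_finsum' r (D.support_finite n f a b)]
      exact finsum_congr fun j => by rw [map_smul, LinearMap.smul_apply, smul_comm])
    (fun a b b' => by
      rw [← finsum_add_distrib (D.support_finite n f a b) (D.support_finite n f a b')]
      simp)
    (fun r a b => by
      rw [smul_finsum' r (D.support_finite n f a b)]
      exact finsum_congr fun j => by rw [map_smul, smul_comm])
  map_add' f g := LinearMap.ext₂ fun a b => by
    simp only [LinearMap.mk₂_apply, LinearMap.add_apply]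
    rw [← finsum_add_distrib (D.support_finite n f a b) (D.support_finite n g a b)]
    simp [add_smul]
  map_smul' r f := LinearMap.ext₂ fun a b => by
    simp only [LinearMap.mk₂_apply, LinearMap.smul_apply, RingHom.id_apply]
    rw [smul_finsum' r (D.support_finite n f a b)]
    simp [mul_smul]

theorem res_apply (n : ℤ) (f : R⟦X⟧) (a b : M) :
    D.res n f a b = ∑ᶠ j : ℕ, coeff j f • D.mode (n + j) a b := rfl

theorem res_eq_sum {n : ℤ} {a b : M} {N : ℕ} (h : ∀ j : ℕ, N ≤ j → D.mode (n + j) a b = 0)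
    (f : R⟦X⟧) : D.res n f a b = ∑ j ∈ range N, coeff j f • D.mode (n + j) a b := by
  rw [res_apply]
  refine finsum_eq_sum_of_support_subset _ fun j hj => ?_
  by_contra hc
  simp only [coe_range, Set.mem_Iio, not_lt] at hc
  exact hj (by simp only [h j hc, smul_zero])

theorem res_mem {Q : Submodule R M} {n : ℤ} {f : R⟦X⟧} {a b : M} (h : ∀ k, D.mode k a b ∈ Q) :
    D.res n f a b ∈ Q := by
  obtain ⟨N, hN⟩ := D.exists_bound n a b
  rw [D.res_eq_sum hN]
  exact sum_mem fun j _ => Q.smul_mem _ (h _)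

theorem res_congr {n : ℤ} {a b : M} {N : ℕ} (h : ∀ j : ℕ, N ≤ j → D.mode (n + j) a b = 0)
    {f g : R⟦X⟧} (hfg : ∀ j < N, coeff j f = coeff j g) : D.res n f a b = D.res n g a b := by
  rw [D.res_eq_sum h, D.res_eq_sum h]
  exact sum_congr rfl fun j hj => by rw [hfg j (mem_range.1 hj)]

theorem res_X_mul (n : ℤ) (f : R⟦X⟧) : D.res n (X * f) = D.res (n + 1) f := by
  refine LinearMap.ext₂ fun a b => ?_
  obtain ⟨N, hN⟩ := D.exists_bound (n + 1) a b
  have hN' : ∀ j : ℕ, N + 1 ≤ j → D.mode (n + j) a b = 0 := fun j hj => by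
    have := hN (j - 1) (by omega)
    rwa [show n + 1 + ((j - 1 : ℕ) : ℤ) = n + j by omega] at this
  rw [D.res_eq_sum hN, D.res_eq_sum hN', sum_range_succ']
  simp only [coeff_succ_X_mul, coeff_zero_X_mul, zero_smul, add_zero]
  exact sum_congr rfl fun j _ => by push_cast; rw [add_comm (j : ℤ) 1, add_assoc]

theorem res_X_pow_mul (n : ℤ) (k : ℕ) (f : R⟦X⟧) : D.res n (X ^ k * f) = D.res (n + k) f := by
  induction k generalizing n with
  | zero => simp
  | succ k ih => 
    rw [pow_succ', mul_assoc, res_X_mul, ih, show n + ((k + 1 : ℕ) : ℤ) = n + 1 + k by push_cast; ring]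

/-- The series `(1 + z) ^ s`. -/
local notation "B" => binomialSeries R

theorem res_binomialSeries_add_one (n : ℤ) (s : ℝ) :
    D.res n (B (s + 1)) = D.res n (B s) + D.res (n + 1) (B s) := by
  rw [binomialSeries_add_one, map_add, res_X_mul]

/-- The truncation can be enlarged freely and does not depend on `f` and `g`, so the two orders of
composition can be expanded over one common square of indices. -/
theorem exists_res_res (m k : ℤ) (a b c : M) : ∃ N₀ : ℕ, ∀ N, N₀ ≤ N → ∀ f g : R⟦X⟧,
    D.res m f a (D.res k g b c) = ∑ i ∈ range N, ∑ j ∈ range N,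
      (coeff i f * coeff j g) • D.mode (m + i) a (D.mode (k + j) b c) := by
  obtain ⟨J, hJ⟩ := D.exists_bound k b c
  choose I hI using fun j : ℕ => D.exists_bound m a (D.mode (k + j) b c)
  refine ⟨max J ((range J).sup I), fun N hN f g => ?_⟩
  have hb : ∀ j i : ℕ, N ≤ i → D.mode (m + i) a (D.mode (k + j) b c) = 0 := fun j i hi => by
    by_cases hj : j < J
    · exact hI j i (((le_sup (f := I) (mem_range.2 hj)).trans (le_max_right _ _)).trans
        (hN.trans hi))
    · rw [hJ j (not_lt.1 hj), map_zero]
  rw [D.res_eq_sum fun j hj => hJ j ((le_max_left _ _).trans (hN.trans hj)), map_sum, sum_comm]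
  refine sum_congr rfl fun j _ => ?_
  rw [map_smul, D.res_eq_sum (hb j), smul_sum]
  exact sum_congr rfl fun i _ => by rw [smul_smul, mul_comm]

/-- In the commutator formula the monomial `z^(m+i)` acquires the factor `binom(m+i, l)`, which is
the effect of the `l`-th Hasse derivative on `z^m f(z)`. The double sum therefore regroups into one
residue for each `a_(l) b`. -/
theorem res_commutator {a b c : M} {σ : ℤ}
    (h : ∀ m n : ℤ, D.mode m a (D.mode n b c) - σ • D.mode n b (D.mode m a c) =
      ∑ᶠ l : ℕ, Ring.choose m l • D.mode (m + n - l) (D.mode l a b) c)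
    (m k : ℤ) (f g : R⟦X⟧) :
    ∃ L, D.res m f a (D.res k g b c) - σ • D.res k g b (D.res m f a c) =
      ∑ l ∈ range L, D.res (m + k - l) (hasseShift m l f * g) (D.mode l a b) c := by
  obtain ⟨N₁, h₁⟩ := D.exists_res_res m k a b c
  obtain ⟨N₂, h₂⟩ := D.exists_res_res k m b a c
  obtain ⟨L, hL⟩ := D.exists_bound 0 a b
  simp only [zero_add] at hL
  choose I hI using fun l : ℕ => D.exists_bound (m + k - l) (D.mode l a b) c
  set N := max (max N₁ N₂) (max L ((range L).sup I)) with hN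
  have hLN : ∀ l : ℕ, N ≤ l → D.mode l a b = 0 := fun l hl =>
    hL l (((le_max_left _ _).trans (le_max_right _ _)).trans hl)
  have hb : ∀ l q : ℕ, N ≤ q → D.mode (m + k - l + q) (D.mode l a b) c = 0 := fun l q hq => by
    by_cases hl : l < L
    · exact hI l q (((le_sup (f := I) (mem_range.2 hl)).trans
        ((le_max_right _ _).trans (le_max_right _ _))).trans hq)
    · rw [hL l (not_lt.1 hl), map_zero, LinearMap.zero_apply]
  refine ⟨N, ?_⟩
  have hR : ∀ l ∈ range N, D.res (m + k - l) (hasseShift m l f * g) (D.mode l a b) c =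
      ∑ i ∈ range N, ∑ j ∈ range N, (((Ring.choose (m + i) l : ℤ) : R) * coeff i f * coeff j g) •
        D.mode (m + k - l + (i + j : ℕ)) (D.mode l a b) c := fun l _ => by
    rw [D.res_eq_sum (hb l), ← sum_antidiagonal_smul (hb l)
      (fun i j => ((Ring.choose (m + i) l : ℤ) : R) * coeff i f * coeff j g)]
    refine sum_congr rfl fun q _ => ?_
    rw [coeff_mul]
    simp only [hasseShift, coeff_mk]
  rw [sum_congr rfl hR, h₁ N ((le_max_left _ _).trans (le_max_left _ _)),
    h₂ N ((le_max_right _ _).trans (le_max_left _ _)), sum_comm (s := range N) (t := range N)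
      (f := fun i j => (coeff i g * coeff j f) • D.mode (k + i) b (D.mode (m + j) a c)),
    smul_sum, ← sum_sub_distrib, sum_comm (s := range N) (t := range N)
      (f := fun l i => ∑ j ∈ range N, _)]
  refine sum_congr rfl fun i _ => ?_
  rw [smul_sum, ← sum_sub_distrib, sum_comm]
  refine sum_congr rfl fun j _ => ?_
  rw [mul_comm (coeff j g), smul_comm σ, ← smul_sub, h,
    finsum_eq_sum_of_support_subset (s := range N) _ (fun l hl => by
      by_contra hc
      simp only [coe_range, Set.mem_Iio, not_lt] at hc
      exact hl (by simp only [hLN l hc, map_zero, LinearMap.zero_apply, smul_zero])), smul_sum]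
  refine sum_congr rfl fun l _ => ?_
  rw [mul_assoc, mul_smul _ (coeff i f * coeff j g), mul_smul (coeff i f), mul_smul (coeff i f),
    Int.cast_smul_eq_zsmul, smul_comm (Ring.choose (m + i) l) (coeff i f),
    smul_comm (Ring.choose (m + i) l) (coeff j g),
    show m + i + (k + j) - l = m + k - l + (i + j : ℕ) by push_cast; ring]

/-- Of the `l = u + v` derivatives, `u` fall on `(1+z)^s` and `v` on `z^m`; the hypothesis lists the
residues that result. -/
theorem res_commutator_mem {i j k x y z Δ Δ' Δ'' a b c} (ha : D.Homog i x Δ a)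
    (hb : D.Homog j y Δ' b) (hc : D.Homog k z Δ'' c) {Q : Submodule R M} (m n : ℤ) (s t : ℝ)
    (hQ : ∀ u v : ℕ,
      D.res (m - v + n) (B (s - u + t)) (D.mode (u + v : ℕ) a b) c ∈ Q) :
    D.res m (B s) a (D.res n (B t) b c) -
      koszulSign i j • D.res n (B t) b (D.res m (B s) a c) ∈ Q := by
  obtain ⟨L, hL⟩ := D.res_commutator (fun m n => D.commutator m n ha hb hc) m n (B s) (B t)
  rw [hL]
  refine sum_mem fun l _ => ?_
  rw [hasseShift_binomialSeries, sum_mul, map_sum, LinearMap.sum_apply, LinearMap.sum_apply]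
  refine sum_mem fun uv huv => ?_
  have huv := mem_antidiagonal.1 huv
  rw [smul_mul_assoc, map_smul, LinearMap.smul_apply, LinearMap.smul_apply]
  refine Q.smul_mem _ ?_
  rw [mul_assoc, ← binomialSeries_add, res_X_pow_mul, ← huv]
  rw [show m + n - ((uv.1 + uv.2 : ℕ) : ℤ) + uv.1 = m - uv.2 + n by push_cast; ring]
  exact hQ uv.1 uv.2

end ModeAlgebra
end

noncomputable section

open PowerSeries Finset

namespace ModeAlgebra

variable {Γ : AddSubgroup ℝ} {R M : Type*} [CommRing R] [Algebra ℝ R] [AddCommGroup M] [Module R M]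
  (D : ModeAlgebra Γ R M)

local notation "B" => binomialSeries R

/-! ### The submodule `J` -/

/-- The elements `(T + H) a` with `a` homogeneous and `ε_a = 0`. -/
def derivGenerators : Set M :=
  {u | ∃ i x Δ a, D.Homog i x Δ a ∧ epsilon x Δ = 0 ∧
    u = D.mode (-2) a D.vac + algebraMap ℝ R Δ • a}

/-- The elements `a_[-2p-2+χ(a,b)] b`, for homogeneous `a`, `b` with `[ε_a] + [ε_b] = [0]`. -/
def circGenerators (p : ℕ) : Set M :=
  {u | ∃ i j x y Δ Δ' a b, D.Homog i x Δ a ∧ D.Homog j y Δ' b ∧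
    (∃ m : ℤ, epsilon x Δ + epsilon y Δ' = m) ∧
    u = D.res (-2 * (p : ℤ) - 2 + chi x Δ y Δ') (B (gammaIndex x Δ + p)) a b}

/-- The span of the two families of generators. -/
def ideal (p : ℕ) : Submodule R M := Submodule.span R (D.derivGenerators ∪ D.circGenerators p)

variable {D}

theorem Homog.translate {i x Δ a} (ha : D.Homog i x Δ a) :
    D.Homog i x (Δ + 1) (D.mode (-2) a D.vac) := by
  have := D.mode_homog (-2) ha D.vac_homog
  rw [add_zero, add_zero] at this
  convert this using 1
  push_cast
  ring

theorem epsilon_add_one (x : ModInt Γ) (Δ : ℝ) : epsilon x (Δ + 1) = epsilon x Δ := by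
  simpa using epsilon_add_intCast x Δ 1

theorem chi_le_one (x y : ModInt Γ) (Δ Δ' : ℝ) : chi x Δ y Δ' ≤ 1 := by
  unfold chi; split_ifs <;> norm_num

theorem chi_congr {x x' y y' : ModInt Γ} {Δ Δ' Δ₁ Δ₁' : ℝ} (h : epsilon x Δ = epsilon x' Δ₁)
    (h' : epsilon y Δ' = epsilon y' Δ₁') : chi x Δ y Δ' = chi x' Δ₁ y' Δ₁' := by
  unfold chi; rw [h, h']

theorem chi_eq_zero {x y : ModInt Γ} {Δ Δ' : ℝ} (h : epsilon x Δ = 0) (h' : epsilon y Δ' = 0) :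
    chi x Δ y Δ' = 0 := by
  unfold chi; rw [h, h']; norm_num

variable (D) in
-- Integration by parts, since `Y(T a, z) = ∂Y(a, z)` and the derivative of `z^n (1+z)^(s+1)` is `n
-- z^(n-1) (1+z)^s + (n+s+1) z^n (1+z)^s`.
theorem res_translate (n : ℤ) (s : ℝ) (a b : M) :
    D.res n (B (s + 1)) (D.mode (-2) a D.vac) b =
      -(n • D.res (n - 1) (B s) a b + algebraMap ℝ R (n + s + 1) • D.res n (B s) a b) := by
  obtain ⟨N, hN⟩ := D.exists_bound (n - 1) a b
  have hT : ∀ j : ℕ, D.mode (n + j) (D.mode (-2) a D.vac) b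
      = (-(n + j : ℤ) : R) • D.mode (n - 1 + j) a b := fun j => by
    rw [D.translation, ← Int.cast_neg, Int.cast_smul_eq_zsmul,
      show n - 1 + (j : ℤ) = n + j - 1 by ring]
  have h1 : D.res n (B s) = D.res (n - 1) (X * B s) := by rw [res_X_mul, sub_add_cancel]
  rw [D.res_eq_sum (N := N) (fun j hj => by rw [hT, hN j hj, smul_zero]), h1,
    D.res_eq_sum hN, D.res_eq_sum hN, smul_sum, smul_sum, ← sum_add_distrib, ← sum_neg_distrib]
  refine sum_congr rfl fun j _ => ?_
  rw [hT, smul_smul, smul_smul, ← Int.cast_smul_eq_zsmul R, smul_smul, ← add_smul, ← neg_smul]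
  congr 1
  cases j with
  | zero =>
    simp
  | succ j =>
    rw [coeff_succ_X_mul]
    simp only [binomialSeries_coeff, Algebra.smul_def, mul_one]
    have h2 := congrArg (algebraMap ℝ R) (Ring.succ_mul_choose_succ s j)
    have h3 := congrArg (algebraMap ℝ R) (Ring.choose_succ_succ s j)
    simp only [map_mul, map_add, map_sub, map_natCast, map_one, map_intCast] at h2 h3 ⊢
    rw [h3]
    push_cast
    linear_combination -h2

/-- The submodule `J` contains all residues with poles of higher order. -/
theorem res_mem_ideal {p : ℕ} {i j x y Δ Δ' a b} (ha : D.Homog i x Δ a) (hb : D.Homog j y Δ' b)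
    (h : ∃ m : ℤ, epsilon x Δ + epsilon y Δ' = m) {n : ℤ} {s : ℝ} (k l : ℕ) (hl : l ≤ k)
    (hn : n = -2 * (p : ℤ) - 2 + chi x Δ y Δ' - k) (hs : s = gammaIndex x Δ + p + l) :
    D.res n (B s) a b ∈ D.ideal p := by
  subst hn hs
  induction l generalizing k with
  | zero =>
    clear hl
    induction k generalizing a Δ with
    | zero =>
      refine Submodule.subset_span (Or.inr ⟨i, j, x, y, Δ, Δ', a, b, ha, hb, h, ?_⟩)
      simp
    | succ k ih =>
      have hε := epsilon_add_one x Δ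
      -- Passing to `T a` raises `γ` by one and leaves `χ` unchanged. Integration by parts then
      -- expresses the residue with one more pole through residues already known to lie in `J`.
      have h1 := ih ha.translate (by rwa [hε])
      have h2 := ih ha h
      have hγ : gammaIndex x (Δ + 1) = gammaIndex x Δ + 1 := by
        unfold gammaIndex; rw [hε]; ring
      rw [chi_congr hε rfl, hγ, show gammaIndex x Δ + 1 + p + (0 : ℕ)
        = gammaIndex x Δ + p + (0 : ℕ) + 1 by ring, res_translate, neg_mem_iff] at h1
      have h3 := (Submodule.add_mem_iff_left _ (Submodule.smul_mem _ _ h2)).1 h1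
      set N : ℤ := -2 * (p : ℤ) - 2 + chi x Δ y Δ' - k with hN
      -- As `χ ≤ 1`, the exponent is at most `-2p - 1 < 0`, so the coefficient from the integration
      -- by parts is invertible.
      have hN0 : (N : ℝ) ≠ 0 := by
        have := chi_le_one x y Δ Δ'
        exact_mod_cast (by omega : N ≠ 0)
      have h4 := Submodule.smul_mem _ (algebraMap ℝ R (N : ℝ)⁻¹) h3
      rw [← Int.cast_smul_eq_zsmul R, smul_smul, ← map_intCast (algebraMap ℝ R), ← map_mul,
        inv_mul_cancel₀ hN0, map_one, one_smul] at h4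
      rwa [show N - 1 = -2 * (p : ℤ) - 2 + chi x Δ y Δ' - (k + 1 : ℕ) by
        rw [hN]; push_cast; ring] at h4
  | succ l ih =>
    -- From `(1+z)^(s+1) = (1+z)^s + z (1+z)^s`: the second term loses one pole, so each extra power
    -- of `1+z` costs one extra pole. This is the role of `l ≤ k`.
    obtain ⟨k, rfl⟩ : ∃ k', k = k' + 1 := ⟨k - 1, by omega⟩
    have h1 := ih (k + 1) (by omega)
    have h2 := ih k (by omega)
    rw [show gammaIndex x Δ + p + ((l + 1 : ℕ) : ℝ) = gammaIndex x Δ + p + l + 1 by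
      push_cast; ring, res_binomialSeries_add_one, LinearMap.add_apply, LinearMap.add_apply]
    rw [show -2 * (p : ℤ) - 2 + chi x Δ y Δ' - k
      = -2 * (p : ℤ) - 2 + chi x Δ y Δ' - (k + 1 : ℕ) + 1 by push_cast; ring] at h2
    exact add_mem h1 h2

/-! ### Skew-symmetry -/

/-- Here `a_(-1-l) vac` is `T^l a / l!`. Modulo `J`, `T` acts as `-H`, and each application raises
the weight by one, which produces `(-Δ)(-Δ-1)⋯(-Δ-l+1) / l!`. -/
theorem mode_vac_sub_mem {p : ℕ} {i x Δ a} (ha : D.Homog i x Δ a) (h : epsilon x Δ = 0) (l : ℕ) :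
    D.mode (-1 - l) a D.vac - algebraMap ℝ R (Ring.choose (-Δ) l) • a ∈ D.ideal p := by
  induction l generalizing a Δ with
  | zero => simp [D.creation]
  | succ l ih =>
    have h1 := ih ha.translate (by rwa [epsilon_add_one])
    have h2 : D.mode (-2) a D.vac + algebraMap ℝ R Δ • a ∈ D.ideal p :=
      Submodule.subset_span (Or.inl ⟨i, x, Δ, a, ha, h, rfl⟩)
    have h3 := add_mem h1 (Submodule.smul_mem _
      (algebraMap ℝ R (Ring.choose (-(Δ + 1)) l)) h2)
    have h4 := Ring.choose_succ_mul (-Δ) l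
    rw [D.translation, ← Int.cast_smul_eq_zsmul R] at h3
    have h5 := Submodule.smul_mem _ (algebraMap ℝ R ((l : ℝ) + 1)⁻¹) h3
    have h6 : ((l : ℝ) + 1) ≠ 0 := by positivity
    have h7 : algebraMap ℝ R ((l : ℝ) + 1)⁻¹ * algebraMap ℝ R ((l : ℝ) + 1) = 1 := by
      rw [← map_mul, inv_mul_cancel₀ h6, map_one]
    have h8 := congrArg (algebraMap ℝ R) h4
    rw [map_mul, map_mul, map_neg, show -Δ - 1 = -(Δ + 1) by ring] at h8
    rw [show -1 - ((l + 1 : ℕ) : ℤ) = -1 - l - 1 by push_cast; ring]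
    convert h5 using 1
    have h9 : ((-(-1 - (l : ℤ)) : ℤ) : R) = algebraMap ℝ R ((l : ℝ) + 1) := by
      simp
    rw [h9]
    set r := algebraMap ℝ R ((l : ℝ) + 1)
    set q := algebraMap ℝ R ((l : ℝ) + 1)⁻¹
    set c := algebraMap ℝ R (Ring.choose (-Δ) (l + 1))
    set d := algebraMap ℝ R (Ring.choose (-(Δ + 1)) l)
    set e := algebraMap ℝ R Δ
    have h10 : c = - (q * (d * e)) := by linear_combination q * h8 - c * h7
    rw [h10]
    simp only [smul_add, smul_sub, smul_smul, h7, one_smul]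
    module

/-- Skew-symmetry writes `a_(n) b` through the `T^l (b_(n+l) a) / l!`, and `mode_vac_sub_mem` turns
these divided powers into numbers. As `b_(n+l) a` has weight `Δ + Δ' - n - l - 1`, the coefficient
becomes `binom(Δ + Δ' - n - 2, l)`, with an upper entry independent of `l`. -/
theorem mode_swap {p : ℕ} {i j x y Δ Δ' a b} (ha : D.Homog i x Δ a) (hb : D.Homog j y Δ' b)
    (h : epsilon (x + y) (Δ + Δ') = 0) (n : ℤ) :
    D.mode n a b + (koszulSign i j * n.negOnePow) • D.res n (B (Δ + Δ' - n - 2)) b a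
      ∈ D.ideal p := by
  have hs := D.skew n hb ha
  have hσ : (koszulSign j i * n.negOnePow) * (koszulSign i j * n.negOnePow) = 1 := by
    have h1 := koszulSign_mul_self i j
    have h2 : ((n.negOnePow : ℤˣ) : ℤ) * n.negOnePow = 1 := by
      rw [← Units.val_mul, Int.units_mul_self]; rfl
    rw [koszulSign_comm j i]
    linear_combination ((n.negOnePow : ℤˣ) : ℤ) * n.negOnePow * h1 + h2
  have hab : D.mode n a b = -((koszulSign i j * n.negOnePow) • ∑ᶠ l : ℕ,
      (-1 : ℤ) ^ l • D.mode (-1 - l) (D.mode (n + l) b a) D.vac) := by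
    rw [hs, smul_neg, neg_neg, smul_smul, mul_comm, hσ, one_smul]
  obtain ⟨N, hN⟩ := D.exists_bound n b a
  rw [hab, finsum_eq_sum_of_support_subset (s := range N) _ (fun l hl => by
      by_contra hc
      simp only [coe_range, Set.mem_Iio, not_lt] at hc
      exact hl (by simp only [hN l hc, map_zero, LinearMap.zero_apply, smul_zero])),
    D.res_eq_sum hN, neg_add_eq_sub, ← smul_sub, ← sum_sub_distrib]
  refine zsmul_mem (sum_mem fun l _ => ?_) _
  have h1 := D.mode_homog (n + l) hb ha
  have h2 := mode_vac_sub_mem (p := p) h1 (by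
    rw [add_comm y x, add_comm Δ' Δ, ← h, ← epsilon_add_intCast _ (Δ + Δ') (-(n + l) - 1)]
    push_cast; ring_nf) l
  rw [← neg_mem_iff, neg_sub]
  convert zsmul_mem h2 ((-1) ^ l) using 1
  rw [smul_sub, ← Int.cast_smul_eq_zsmul R, ← Int.cast_smul_eq_zsmul R, smul_smul]
  congr 2
  have h3 := congrArg (algebraMap ℝ R)
    (Ring.neg_one_pow_mul_choose (-(Δ' + Δ - ((n + l : ℤ) : ℝ) - 1)) l)
  rw [map_mul, map_pow, map_neg, map_one] at h3
  push_cast at h3 ⊢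
  rw [h3, binomialSeries_coeff, Algebra.smul_def, mul_one]
  congr 2
  ring

/-- The change of variable `z ↦ -z/(1+z)` in the residue: it sends `z^n (1+z)^s dz` to a kernel of
the same kind, whose exponent is fixed by the condition on `s + t`. -/
theorem res_swap {p : ℕ} {i j x y Δ Δ' a b} (ha : D.Homog i x Δ a) (hb : D.Homog j y Δ' b)
    (h : epsilon (x + y) (Δ + Δ') = 0) (n : ℤ) {s t : ℝ} (hst : s + t = Δ + Δ' - n - 2) :
    D.res n (B s) a b + (koszulSign i j * n.negOnePow) • D.res n (B t) b a ∈ D.ideal p := by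
  obtain ⟨N₁, h₁⟩ := D.exists_bound n a b
  obtain ⟨N₂, h₂⟩ := D.exists_bound n b a
  set N := max N₁ N₂
  have hb' : ∀ q : ℕ, N ≤ q → D.mode (n + q) b a = 0 := fun q hq =>
    h₂ q ((le_max_right _ _).trans hq)
  have h3 : D.res n (B t) b a = ∑ l ∈ range N, ((-1) ^ l * algebraMap ℝ R (Ring.choose s l)) •
      D.res (n + l) (B (Δ + Δ' - (n + l) - 2)) b a := by
    -- With `x = s + t`, this is the expansion `(1+z)^t = (1+z)^x (1 - z/(1+z))^s = ∑ (-1)^l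
    -- binom(s, l) z^l (1+z)^(x-l)`, truncated to the coefficients that the residue sees.
    have h4 : D.res n (B t) b a = D.res n (∑ l ∈ range N,
        ((-1) ^ l * algebraMap ℝ R (Ring.choose s l)) •
          (X ^ l * B (Δ + Δ' - (n + l) - 2))) b a := by
      refine D.res_congr hb' fun q hq => ?_
      have h5 := congrArg (algebraMap ℝ R)
        (Ring.sum_neg_one_pow_mul_choose s (Δ + Δ' - n - 2) q)
      rw [← hst, add_sub_cancel_left, Nat.sum_antidiagonal_eq_sum_range_succ_mk, map_sum] at h5
      rw [binomialSeries_coeff, Algebra.smul_def, mul_one, ← h5, map_sum,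
        ← sum_subset (range_subset_range.2 (Nat.succ_le_of_lt hq)) (fun l _ hl => by
          rw [coeff_smul, coeff_X_pow_mul', if_neg (by simpa using hl), smul_zero])]
      refine sum_congr rfl fun l hl => ?_
      have hl := mem_range.1 hl
      rw [coeff_smul, coeff_X_pow_mul', if_pos (by omega), binomialSeries_coeff, smul_eq_mul,
        Algebra.smul_def, mul_one, map_mul, map_mul, map_pow, map_neg, map_one, hst]
      congr 3
      ring
    rw [h4, map_sum, LinearMap.sum_apply, LinearMap.sum_apply]
    refine sum_congr rfl fun l _ => ?_
    rw [map_smul, LinearMap.smul_apply, LinearMap.smul_apply, res_X_pow_mul]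
  rw [h3, D.res_eq_sum (N := N) fun j hj => h₁ j ((le_max_left _ _).trans hj), smul_sum,
    ← sum_add_distrib]
  refine sum_mem fun l _ => ?_
  have h6 := Submodule.smul_mem _ (algebraMap ℝ R (Ring.choose s l))
    (mode_swap (p := p) ha hb h (n + l))
  convert h6 using 1
  rw [Int.negOnePow_add, Units.val_mul, Int.coe_negOnePow_natCast, binomialSeries_coeff, Algebra.smul_def, mul_one,
    smul_add]
  congr 1
  rw [← Int.cast_smul_eq_zsmul R, ← Int.cast_smul_eq_zsmul R, smul_smul, smul_smul]
  push_cast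
  congr 1
  ring

end ModeAlgebra
end

noncomputable section

open PowerSeries Finset

namespace ModeAlgebra

variable {Γ : AddSubgroup ℝ} {R M : Type*} [CommRing R] [Algebra ℝ R] [AddCommGroup M] [Module R M]
  (D : ModeAlgebra Γ R M)

local notation "B" => binomialSeries R

/-! ### The product with a homogeneous element -/

/-- The operator `a *_p b`, as an operation for `a` of weight `Δ` with `ε_a = 0`. -/
def leftOp (p : ℕ) (Δ : ℝ) : M →ₗ[R] M →ₗ[R] M :=
  ∑ m ∈ range (p + 1), Ring.choose (-(p : ℤ) - 1) m • D.res (-(p : ℤ) - 1 - m) (B (Δ + p))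

/-- The operator that agrees, up to sign and modulo `J`, with right multiplication by an element
of weight `Δ`. -/
def rightOp (p : ℕ) (Δ : ℝ) : M →ₗ[R] M →ₗ[R] M :=
  ∑ m ∈ range (p + 1), ((-1) ^ (p + m) * Ring.choose (-(p : ℤ) - 1) m) •
    D.res (-(p : ℤ) - 1 - m) (B (Δ - 1 + m))

/-- The operator `[a, b]` for `a` of weight `Δ` with `ε_a = 0`. -/
def adOp (Δ : ℝ) : M →ₗ[R] M →ₗ[R] M := D.res 0 (B (Δ - 1))

theorem leftOp_apply (p : ℕ) (Δ : ℝ) (a b : M) : D.leftOp p Δ a b = ∑ m ∈ range (p + 1),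
    Ring.choose (-(p : ℤ) - 1) m • D.res (-(p : ℤ) - 1 - m) (B (Δ + p)) a b := by
  simp [leftOp, LinearMap.sum_apply]

theorem rightOp_apply (p : ℕ) (Δ : ℝ) (a b : M) : D.rightOp p Δ a b = ∑ m ∈ range (p + 1),
    ((-1) ^ (p + m) * Ring.choose (-(p : ℤ) - 1) m) •
      D.res (-(p : ℤ) - 1 - m) (B (Δ - 1 + m)) a b := by
  simp only [rightOp, LinearMap.sum_apply, LinearMap.smul_apply]

theorem _root_.Ring.choose_neg_sub_one (p m : ℕ) :
    Ring.choose (-(p : ℤ) - 1) m = (-1) ^ m * ((p + m).choose m : ℤ) := by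
  rw [show -(p : ℤ) - 1 = -((p : ℤ) + 1) by ring, Ring.choose_neg,
    show (p : ℤ) + 1 + m - 1 = ((p + m : ℕ) : ℤ) by push_cast; ring, Ring.choose_natCast,
    Units.smul_def, smul_eq_mul, Int.coe_negOnePow_natCast]

/-- After factoring out `z^(-2p-1) (1+z)^(Δ-1)`, the kernels differ by `z^(2p+1)`: this is
`sum_choose_mul_pow` at `-1` and `1+z`, whose sum is `z`. The equality is exact, not merely modulo
`J`. -/
theorem leftOp_sub_rightOp (p : ℕ) (Δ : ℝ) : D.leftOp p Δ - D.rightOp p Δ = D.adOp Δ := by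
  have h1 : ∀ m ∈ range (p + 1), ∀ f, D.res (-(p : ℤ) - 1 - m) f
      = D.res (-2 * (p : ℤ) - 1) (X ^ (p - m) * f) := fun m hm f => by
    have := mem_range.1 hm
    rw [res_X_pow_mul]
    congr 2
    omega
  have h2 : D.adOp Δ = D.res (-2 * (p : ℤ) - 1) (X ^ (2 * p + 1) * B (Δ - 1)) := by
    rw [res_X_pow_mul, adOp]
    congr 2
    push_cast
    ring
  have h3 : D.leftOp p Δ = D.res (-2 * (p : ℤ) - 1) (∑ m ∈ range (p + 1),
      Ring.choose (-(p : ℤ) - 1) m • (X ^ (p - m) * B (Δ + p))) := by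
    rw [leftOp, map_sum]
    exact sum_congr rfl fun m hm => by rw [h1 m hm, map_zsmul]
  have h4 : D.rightOp p Δ = D.res (-2 * (p : ℤ) - 1) (∑ m ∈ range (p + 1),
      ((-1) ^ (p + m) * Ring.choose (-(p : ℤ) - 1) m) • (X ^ (p - m) * B (Δ - 1 + m))) := by
    rw [rightOp, map_sum]
    exact sum_congr rfl fun m hm => by rw [h1 m hm, map_zsmul]
  rw [h3, h4, h2, ← map_sub]
  congr 1
  have h5 := sum_choose_mul_pow (-1 : R⟦X⟧) (1 + X) p
  rw [neg_add_cancel_left] at h5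
  rw [← h5, add_mul, sub_eq_add_neg, ← sum_neg_distrib, mul_sum, mul_sum, sum_mul, sum_mul]
  congr 1
  · refine sum_congr rfl fun m _ => ?_
    rw [show Δ + p = Δ - 1 + ((p + 1 : ℕ) : ℝ) by push_cast; ring, binomialSeries_add,
      binomialSeries_nat, Ring.choose_neg_sub_one, zsmul_eq_mul]
    push_cast
    ring
  · refine sum_congr rfl fun m _ => ?_
    have h6 : (-1 : R⟦X⟧) ^ m * (-1) ^ m = 1 := by rw [← mul_pow]; simp
    rw [binomialSeries_add, binomialSeries_nat, Ring.choose_neg_sub_one, zsmul_eq_mul]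
    push_cast
    rw [pow_add, pow_succ]
    linear_combination (-(-1) ^ p * ((p + m).choose m : R⟦X⟧) * X ^ (p - m) * B (Δ - 1) *
      (1 + X) ^ m) * h6

theorem leftOp_eq (p : ℕ) (Δ : ℝ) (a b : M) :
    D.leftOp p Δ a b = D.rightOp p Δ a b + D.adOp Δ a b := by
  rw [← leftOp_sub_rightOp D p Δ]
  simp

theorem leftOp_mem {Q : Submodule R M} {p : ℕ} {Δ : ℝ} {a b : M} (h : ∀ k, D.mode k a b ∈ Q) :
    D.leftOp p Δ a b ∈ Q := by
  rw [leftOp_apply]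
  exact sum_mem fun m _ => zsmul_mem (D.res_mem h) _

variable {D}

/-- Termwise `res_swap`: for `n = -p-1-m`, the exponent paired with `Δ + p` is `Δ' - 1 + m`, which
is how the kernel of `rightOp` is chosen. -/
theorem leftOp_sub_rightOp_mem {p : ℕ} {i j x y Δ Δ' a b} (ha : D.Homog i x Δ a)
    (hb : D.Homog j y Δ' b) (h : epsilon x Δ = 0) (h' : epsilon y Δ' = 0) :
    D.leftOp p Δ a b - koszulSign i j • D.rightOp p Δ' b a ∈ D.ideal p := by
  rw [leftOp_apply, rightOp_apply, smul_sum, ← sum_sub_distrib]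
  refine sum_mem fun m _ => ?_
  have h1 := res_swap (p := p) ha hb (epsilon_add_eq_zero h h') (-(p : ℤ) - 1 - m)
    (s := Δ + p) (t := Δ' - 1 + m) (by push_cast; ring)
  convert zsmul_mem h1 (Ring.choose (-(p : ℤ) - 1) m) using 1
  rw [smul_add, sub_eq_add_neg, smul_smul, smul_smul, ← neg_smul]
  congr 2
  rw [show -(p : ℤ) - 1 - m = -((p + m + 1 : ℕ) : ℤ) by push_cast; ring, Int.negOnePow_neg,
    Int.coe_negOnePow_natCast]
  ring

theorem leftOp_sub_leftOp_mem {p : ℕ} {i j x y Δ Δ' a b} (ha : D.Homog i x Δ a)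
    (hb : D.Homog j y Δ' b) (h : epsilon x Δ = 0) (h' : epsilon y Δ' = 0) :
    D.leftOp p Δ a b - koszulSign i j • D.leftOp p Δ' b a - D.adOp Δ a b ∈ D.ideal p := by
  have h1 := zsmul_mem (leftOp_sub_rightOp_mem (p := p) hb ha h' h) (koszulSign i j)
  rw [koszulSign_comm j i, smul_sub, smul_smul, koszulSign_mul_self, one_smul] at h1
  rw [leftOp_eq]
  convert neg_mem h1 using 1
  abel

/-! ### Products and the generators of `J` -/

/-- Each `u_(q) b` has the same `ε` as `b`, so applying the `a`-residue to it gives another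
generator of `J`. When `u` acts on a generator built from `a` and `b`, only the commutator remains
to be treated. -/
theorem res_res_mem {p : ℕ} {i j k x y z Δ Δ' Δ'' u a b} (hu : D.Homog i x Δ u)
    (ha : D.Homog j y Δ' a) (hb : D.Homog k z Δ'' b) (h : epsilon x Δ = 0)
    (h' : ∃ m : ℤ, epsilon y Δ' + epsilon z Δ'' = m) (n : ℤ) (f : R⟦X⟧) :
    D.res (-2 * (p : ℤ) - 2 + chi y Δ' z Δ'') (B (gammaIndex y Δ' + p)) a (D.res n f u b)
      ∈ D.ideal p := by
  refine D.res_mem (Q := (D.ideal p).comap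
    (D.res (-2 * (p : ℤ) - 2 + chi y Δ' z Δ'') (B (gammaIndex y Δ' + p)) a)) fun q => ?_
  have hε := epsilon_add_left h z Δ'' q
  exact res_mem_ideal ha (D.mode_homog q hu hb) (by rwa [hε]) 0 0 le_rfl
    (by rw [chi_congr rfl hε]; simp) (by simp)

/-- The commutator of two residue operations, when the kernels have enough poles. -/
theorem res_commutator_mem_ideal {p : ℕ} {i j k x y z Δ Δ' Δ'' u a b} (hu : D.Homog i x Δ u)
    (ha : D.Homog j y Δ' a) (hb : D.Homog k z Δ'' b) (h : epsilon x Δ = 0)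
    (h' : ∃ m : ℤ, epsilon y Δ' + epsilon z Δ'' = m) (m n : ℤ) (s t : ℝ) (c d : ℕ) (hcd : c ≤ d)
    (hmn : m + n = -2 * (p : ℤ) - 2 + chi y Δ' z Δ'' - d)
    (hst : s + t = Δ - 1 + gammaIndex y Δ' + p + c) :
    D.res m (B s) u (D.res n (B t) a b) -
      koszulSign i j • D.res n (B t) a (D.res m (B s) u b) ∈ D.ideal p := by
  refine D.res_commutator_mem hu ha hb m n s t fun q r => ?_
  have hε := epsilon_add_left h y Δ' (q + r : ℕ)
  -- The element `u_(q+r) a` has index `γ_a + Δ - 1 - q - r`, while the exponent of `1+z` drops only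
  -- by `q`. Relative to the new index, the `r` derivatives of the power of `z` give `r` extra poles
  -- and `r` extra powers of `1+z`, so the inequality `c ≤ d` is preserved.
  refine res_mem_ideal (D.mode_homog _ hu ha) hb (by rwa [hε]) (d + r) (c + r) (by omega) ?_ ?_
  · rw [chi_congr hε rfl]
    push_cast
    linarith
  · unfold gammaIndex at hst ⊢
    rw [hε]
    push_cast
    linarith

theorem leftOp_circ_mem {p : ℕ} {i j k x y z Δ Δ' Δ'' u a b} (hu : D.Homog i x Δ u)
    (ha : D.Homog j y Δ' a) (hb : D.Homog k z Δ'' b) (h : epsilon x Δ = 0)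
    (h' : ∃ m : ℤ, epsilon y Δ' + epsilon z Δ'' = m) :
    D.leftOp p Δ u (D.res (-2 * (p : ℤ) - 2 + chi y Δ' z Δ'') (B (gammaIndex y Δ' + p)) a b)
      ∈ D.ideal p := by
  rw [leftOp_apply]
  refine sum_mem fun m _ => zsmul_mem ?_ _
  have h1 := res_commutator_mem_ideal (p := p) hu ha hb h h' (-(p : ℤ) - 1 - m)
    (-2 * (p : ℤ) - 2 + chi y Δ' z Δ'') (Δ + p) (gammaIndex y Δ' + p) (p + 1) (p + 1 + m)
    (by omega) (by push_cast; ring) (by push_cast; ring)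
  exact (Submodule.sub_mem_iff_left _ (zsmul_mem (res_res_mem hu ha hb h h' _ _) _)).1 h1

theorem adOp_circ_mem {p : ℕ} {i j k x y z Δ Δ' Δ'' u a b} (hu : D.Homog i x Δ u)
    (ha : D.Homog j y Δ' a) (hb : D.Homog k z Δ'' b) (h : epsilon x Δ = 0)
    (h' : ∃ m : ℤ, epsilon y Δ' + epsilon z Δ'' = m) :
    D.adOp Δ u (D.res (-2 * (p : ℤ) - 2 + chi y Δ' z Δ'') (B (gammaIndex y Δ' + p)) a b)
      ∈ D.ideal p := by
  have h1 := res_commutator_mem_ideal (p := p) hu ha hb h h' 0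
    (-2 * (p : ℤ) - 2 + chi y Δ' z Δ'') (Δ - 1) (gammaIndex y Δ' + p) 0 0
    le_rfl (by simp) (by simp; ring)
  exact (Submodule.sub_mem_iff_left _ (zsmul_mem (res_res_mem hu ha hb h h' _ _) _)).1 h1

/-- Left and right multiplications commute modulo `J`. -/
theorem leftOp_rightOp_sub_mem {p : ℕ} {i j k x y z Δ Δ' Δ'' a b c} (ha : D.Homog i x Δ a)
    (hb : D.Homog j y Δ' b) (hc : D.Homog k z Δ'' c) (hx : epsilon x Δ = 0)
    (hy : epsilon y Δ' = 0) (hz : epsilon z Δ'' = 0) :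
    D.leftOp p Δ a (D.rightOp p Δ'' c b) -
      koszulSign i k • D.rightOp p Δ'' c (D.leftOp p Δ a b) ∈ D.ideal p := by
  have h0 : D.rightOp p Δ'' c (D.leftOp p Δ a b) = ∑ m ∈ range (p + 1),
      Ring.choose (-(p : ℤ) - 1) m • D.rightOp p Δ'' c (D.res (-(p : ℤ) - 1 - m) (B (Δ + p)) a b) := by
    simp only [leftOp_apply, map_sum, map_zsmul]
  rw [h0, leftOp_apply, smul_sum, ← sum_sub_distrib]
  refine sum_mem fun m _ => ?_
  rw [rightOp_apply, rightOp_apply, map_sum, smul_sum, smul_sum, smul_sum, ← sum_sub_distrib]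
  refine sum_mem fun m' _ => ?_
  -- The two kernels together have pole order `2p + 2 + m + m'`, hence `m + m'` surplus poles. The
  -- exponents exceed the reference value by `m'`, which does not exceed this surplus.
  have h1 := res_commutator_mem_ideal (p := p) ha hc hb hx ⟨0, by rw [hy, hz]; simp⟩
    (-(p : ℤ) - 1 - m) (-(p : ℤ) - 1 - m') (Δ + p) (Δ'' - 1 + m') m' (m + m') (by omega)
    (by rw [chi_eq_zero hz hy]; push_cast; ring) (by unfold gammaIndex; rw [hz]; ring)
  convert zsmul_mem (zsmul_mem h1 ((-1) ^ (p + m') * Ring.choose (-(p : ℤ) - 1) m'))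
    (Ring.choose (-(p : ℤ) - 1) m) using 1
  rw [map_zsmul]
  module

/-- Integration by parts with `n = 0` and `s = Δ - 1`: the pole term vanishes and the other
coefficient is `Δ`. -/
theorem adOp_deriv_eq_zero (Δ : ℝ) (a b : M) :
    D.adOp (Δ + 1) (D.mode (-2) a D.vac) b + algebraMap ℝ R Δ • D.adOp Δ a b = 0 := by
  rw [adOp, adOp, show Δ + 1 - 1 = Δ - 1 + 1 by ring, res_translate]
  simp

/-- Modulo `J`, `res_swap` at `n = 0` reduces this to the bracket with `(T + H) v` on the left,
which is zero. -/
theorem adOp_deriv_mem {p : ℕ} {i j x y Δ Δ' u v} (hu : D.Homog i x Δ u) (hv : D.Homog j y Δ' v)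
    (hx : epsilon x Δ = 0) (hy : epsilon y Δ' = 0) :
    D.adOp Δ u (D.mode (-2) v D.vac + algebraMap ℝ R Δ' • v) ∈ D.ideal p := by
  have h1 := res_swap (p := p) hu hv.translate
    (epsilon_add_eq_zero hx (by rwa [epsilon_add_one])) 0 (s := Δ - 1) (t := Δ' + 1 - 1)
    (by push_cast; ring)
  have h2 := res_swap (p := p) hu hv (epsilon_add_eq_zero hx hy) 0 (s := Δ - 1) (t := Δ' - 1)
    (by push_cast; ring)
  have h3 := add_mem h1 (Submodule.smul_mem _ (algebraMap ℝ R Δ') h2)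
  have h4 := adOp_deriv_eq_zero (D := D) Δ' v u
  rw [map_add, map_smul]
  convert h3 using 1
  rw [adOp, adOp] at h4
  rw [smul_add, smul_comm (algebraMap ℝ R Δ'), add_add_add_comm, ← smul_add, h4, smul_zero,
    add_zero, adOp]

/-- Integration by parts makes the sum over `m` telescope, because `(m+1) binom(-p-1, m+1) =
-(p+1+m) binom(-p-1, m)`. Only the last boundary term survives, a multiple of the residue with
kernel `z^(-2p-2) (1+z)^(Δ+p)`, which is a generator of `J`. -/
theorem leftOp_deriv_mem {p : ℕ} {i j x y Δ Δ' v u} (hv : D.Homog i x Δ v) (hu : D.Homog j y Δ' u)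
    (hx : epsilon x Δ = 0) (hy : epsilon y Δ' = 0) :
    D.leftOp p (Δ + 1) (D.mode (-2) v D.vac) u + algebraMap ℝ R Δ • D.leftOp p Δ v u
      ∈ D.ideal p := by
  have h1 : ∀ m : ℕ, D.res (-(p : ℤ) - 1 - m) (B (Δ + 1 + p)) (D.mode (-2) v D.vac) u +
      algebraMap ℝ R Δ • D.res (-(p : ℤ) - 1 - m) (B (Δ + p)) v u =
      ((p : ℤ) + 1 + m) • D.res (-(p : ℤ) - 1 - (m + 1 : ℕ)) (B (Δ + p)) v u +
        (m : ℤ) • D.res (-(p : ℤ) - 1 - m) (B (Δ + p)) v u := fun m => by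
    rw [show Δ + 1 + p = Δ + p + 1 by ring, res_translate,
      show -(p : ℤ) - 1 - (m + 1 : ℕ) = -(p : ℤ) - 1 - m - 1 by push_cast; ring]
    simp only [← Int.cast_smul_eq_zsmul R, map_add, map_intCast, map_natCast, map_one]
    push_cast
    module
  have h2 : ∀ m : ℕ, ((m : ℤ) + 1) * Ring.choose (-(p : ℤ) - 1) (m + 1) =
      -((p : ℤ) + 1 + m) * Ring.choose (-(p : ℤ) - 1) m := fun m => by
    have := Ring.choose_smul_choose (-(p : ℤ) - 1) (Nat.le_succ m)
    rw [Nat.choose_succ_self_right, show m + 1 - m = 1 by omega, Ring.choose_one_right,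
      nsmul_eq_mul] at this
    push_cast at this
    linarith
  have h3 : ∀ q : ℕ, ∑ m ∈ range (q + 1), Ring.choose (-(p : ℤ) - 1) m •
      (((p : ℤ) + 1 + m) • D.res (-(p : ℤ) - 1 - (m + 1 : ℕ)) (B (Δ + p)) v u +
        (m : ℤ) • D.res (-(p : ℤ) - 1 - m) (B (Δ + p)) v u) =
      (((p : ℤ) + 1 + q) * Ring.choose (-(p : ℤ) - 1) q) •
        D.res (-(p : ℤ) - 1 - (q + 1 : ℕ)) (B (Δ + p)) v u := fun q => by
    induction q with
    | zero => simp [mul_comm]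
    | succ q ih =>
      rw [sum_range_succ, ih]
      have h4 := h2 q
      have h5 : (((p : ℤ) + 1 + q) * Ring.choose (-(p : ℤ) - 1) q) =
        -(((q : ℤ) + 1) * Ring.choose (-(p : ℤ) - 1) (q + 1)) := by linarith
      rw [h5]
      push_cast
      module
  rw [leftOp_apply, leftOp_apply, smul_sum, ← sum_add_distrib]
  have h6 : ∀ m ∈ range (p + 1), Ring.choose (-(p : ℤ) - 1) m •
      D.res (-(p : ℤ) - 1 - m) (B (Δ + 1 + p)) (D.mode (-2) v D.vac) u +
      algebraMap ℝ R Δ • Ring.choose (-(p : ℤ) - 1) m •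
        D.res (-(p : ℤ) - 1 - m) (B (Δ + p)) v u = Ring.choose (-(p : ℤ) - 1) m •
      (((p : ℤ) + 1 + m) • D.res (-(p : ℤ) - 1 - (m + 1 : ℕ)) (B (Δ + p)) v u +
        (m : ℤ) • D.res (-(p : ℤ) - 1 - m) (B (Δ + p)) v u) := fun m _ => by
    rw [smul_comm (algebraMap ℝ R Δ), ← smul_add, h1]
  rw [sum_congr rfl h6, h3]
  refine zsmul_mem (res_mem_ideal hv hu ⟨0, by rw [hx, hy]; simp⟩ 0 0 le_rfl ?_ ?_) _
  · rw [chi_eq_zero hx hy]; push_cast; ring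
  · unfold gammaIndex; rw [hx]; push_cast; ring

/-! ### The product -/

variable (D) in
/-- The span of the homogeneous elements with `ε = 0` of a given parity. -/
def paritySpan (i : ZMod 2) : Submodule R M :=
  Submodule.span R {a | ∃ x Δ, epsilon x Δ = 0 ∧ D.Homog i x Δ a}

theorem Homog.mem_paritySpan {i x Δ a} (ha : D.Homog i x Δ a) (h : epsilon x Δ = 0) :
    a ∈ D.paritySpan i := Submodule.subset_span ⟨x, Δ, h, ha⟩

theorem mode_mem_paritySpan {i j x y Δ Δ' a b} (ha : D.Homog i x Δ a) (hb : D.Homog j y Δ' b)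
    (h : ∃ m : ℤ, epsilon x Δ + epsilon y Δ' = m) (n : ℤ) :
    D.mode n a b ∈ D.paritySpan (i + j) :=
  (D.mode_homog n ha hb).mem_paritySpan (epsilon_eq_zero x y Δ Δ' n h)

theorem generators_subset {p : ℕ} {u : M} (hu : u ∈ D.derivGenerators ∪ D.circGenerators p) :
    ∃ i, u ∈ D.paritySpan i := by
  rcases hu with ⟨i, x, Δ, a, ha, h, rfl⟩ | ⟨i, j, x, y, Δ, Δ', a, b, ha, hb, h, rfl⟩
  · exact ⟨i, add_mem (ha.translate.mem_paritySpan (by rwa [epsilon_add_one]))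
      (Submodule.smul_mem _ _ (ha.mem_paritySpan h))⟩
  · exact ⟨i + j, D.res_mem fun k => mode_mem_paritySpan ha hb h k⟩

theorem ideal_eq_iSup (p : ℕ) : D.ideal p = ⨆ i, D.ideal p ⊓ D.paritySpan i := by
  refine le_antisymm (Submodule.span_le.2 fun u hu => ?_) (iSup_le fun i => inf_le_left)
  obtain ⟨i, hi⟩ := generators_subset hu
  exact le_iSup (fun i => D.ideal p ⊓ D.paritySpan i) i ⟨Submodule.subset_span hu, hi⟩

variable (D) in
/-- A bilinear operation is a star product if it is given by the defining formula on homogeneous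
elements with `ε = 0`. -/
def IsStar (p : ℕ) (star : M →ₗ[R] M →ₗ[R] M) : Prop :=
  ∀ i x Δ a, D.Homog i x Δ a → epsilon x Δ = 0 → star a = D.leftOp p Δ a

/-! ### The ideal property, associativity and the unit modulo `J`. -/

namespace IsStar

variable {p : ℕ} {star : M →ₗ[R] M →ₗ[R] M}

theorem mem_paritySpan (hs : D.IsStar p star) {i j a b} (ha : a ∈ D.paritySpan i)
    (hb : b ∈ D.paritySpan j) : star a b ∈ D.paritySpan (i + j) := by
  induction ha using Submodule.span_induction with
  | zero => simp
  | add a a' _ _ h h' => rw [map_add, LinearMap.add_apply]; exact add_mem h h'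
  | smul r a _ h => rw [map_smul, LinearMap.smul_apply]; exact Submodule.smul_mem _ _ h
  | mem a ha =>
    obtain ⟨x, Δ, hx, ha⟩ := ha
    induction hb using Submodule.span_induction with
    | zero => simp
    | add b b' _ _ h h' => rw [map_add]; exact add_mem h h'
    | smul r b _ h => rw [map_smul]; exact Submodule.smul_mem _ _ h
    | mem b hb =>
      obtain ⟨y, Δ', hy, hb⟩ := hb
      rw [hs i x Δ a ha hx]
      exact D.leftOp_mem fun k => mode_mem_paritySpan ha hb ⟨0, by rw [hx, hy]; simp⟩ k

theorem sub_rightOp_mem (hs : D.IsStar p star) {i j y Δ v c} (hv : v ∈ D.paritySpan i)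
    (hc : D.Homog j y Δ c) (hy : epsilon y Δ = 0) :
    star v c - koszulSign i j • D.rightOp p Δ c v ∈ D.ideal p := by
  induction hv using Submodule.span_induction with
  | zero => simp
  | add v v' _ _ h h' =>
    rw [map_add, LinearMap.add_apply, map_add, smul_add, add_sub_add_comm]; exact add_mem h h'
  | smul r v _ h =>
    rw [map_smul, LinearMap.smul_apply, map_smul, smul_comm, ← smul_sub]
    exact Submodule.smul_mem _ _ h
  | mem v hv =>
    obtain ⟨x, Δ', hx, hv⟩ := hv
    rw [hs i x Δ' v hv hx]
    exact leftOp_sub_rightOp_mem hv hc hx hy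

theorem adOp_mem {i x Δ u w} (hu : D.Homog i x Δ u) (hx : epsilon x Δ = 0) (hw : w ∈ D.ideal p) :
    D.adOp Δ u w ∈ D.ideal p := by
  change w ∈ (D.ideal p).comap (D.adOp Δ u)
  refine Submodule.span_le.2 ?_ hw
  rintro w (⟨j, y, Δ', v, hv, hy, rfl⟩ | ⟨j, k, y, z, Δ', Δ'', a, b, ha, hb, h, rfl⟩)
  · exact adOp_deriv_mem hu hv hx hy
  · exact adOp_circ_mem hu ha hb hx h

theorem leftOp_mem (hs : D.IsStar p star) {i x Δ u w} (hu : D.Homog i x Δ u)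
    (hx : epsilon x Δ = 0) (hw : w ∈ D.ideal p) : D.leftOp p Δ u w ∈ D.ideal p := by
  change w ∈ (D.ideal p).comap (D.leftOp p Δ u)
  refine Submodule.span_le.2 ?_ hw
  rintro w (⟨j, y, Δ', v, hv, hy, rfl⟩ | ⟨j, k, y, z, Δ', Δ'', a, b, ha, hb, h, rfl⟩)
  -- The product with `(T + H) v` on the left is known to lie in `J`. It is congruent to `± R_u ((T
  -- + H) v)`, so this lies in `J` too, and adding the bracket turns `R_u` into `L_u`.
  · have h1 := leftOp_deriv_mem (p := p) hv hu hy hx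
    have hT : epsilon y (Δ' + 1) = 0 := by rwa [epsilon_add_one]
    have h2 := hs.sub_rightOp_mem (add_mem (hv.translate.mem_paritySpan hT)
      (Submodule.smul_mem _ (algebraMap ℝ R Δ') (hv.mem_paritySpan hy))) hu hx
    rw [map_add, LinearMap.add_apply, map_smul, LinearMap.smul_apply, hs _ _ _ _ hv hy,
      hs _ _ _ _ hv.translate hT] at h2
    have h3 := zsmul_mem ((Submodule.sub_mem_iff_right _ h1).1 h2) (koszulSign j i)
    rw [smul_smul, koszulSign_mul_self, one_smul] at h3
    rw [SetLike.mem_coe, Submodule.mem_comap, leftOp_eq]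
    exact add_mem h3 (adOp_deriv_mem hu hv hx hy)
  · exact leftOp_circ_mem hu ha hb hx h

theorem mem_ideal_left (hs : D.IsStar p star) {i u w} (hu : u ∈ D.paritySpan i)
    (hw : w ∈ D.ideal p) : star u w ∈ D.ideal p := by
  change u ∈ (D.ideal p).comap (star.flip w)
  refine Submodule.span_le.2 ?_ hu
  rintro u ⟨x, Δ, hx, hu⟩
  rw [SetLike.mem_coe, Submodule.mem_comap, LinearMap.flip_apply, hs i x Δ u hu hx]
  exact hs.leftOp_mem hu hx hw

/-- Modulo `J`, `w * u` is `± R_u w = ± (L_u w - [u, w])`, and both terms are in `J`. The sign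
requires `w` of definite parity, whence the reduction to generators. -/
theorem mem_ideal_right (hs : D.IsStar p star) {i u w} (hu : u ∈ D.paritySpan i)
    (hw : w ∈ D.ideal p) : star w u ∈ D.ideal p := by
  change w ∈ (D.ideal p).comap (star.flip u)
  refine Submodule.span_le.2 (fun w hw => ?_) hw
  obtain ⟨j, hj⟩ := generators_subset hw
  have hw := Submodule.subset_span (R := R) hw
  change u ∈ (D.ideal p).comap (star w)
  refine Submodule.span_le.2 ?_ hu
  rintro u ⟨x, Δ, hx, hu⟩
  have h1 : D.rightOp p Δ u w ∈ D.ideal p := by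
    rw [← sub_eq_of_eq_add (D.leftOp_eq p Δ u w)]
    exact sub_mem (hs.leftOp_mem hu hx hw) (adOp_mem hu hx hw)
  exact (Submodule.sub_mem_iff_left _ (zsmul_mem h1 _)).1 (hs.sub_rightOp_mem hj hu hx)

/-- Replacing right multiplication by `c` with `± R_c` on both sides leaves the commutation of `L_a`
with `R_c`. Inside `a * (b * c)` the replacement is allowed because `J` is a left ideal. -/
theorem assoc_mem_of_homog (hs : D.IsStar p star) {i j k x y z Δ Δ' Δ'' a b c}
    (ha : D.Homog i x Δ a) (hb : D.Homog j y Δ' b) (hc : D.Homog k z Δ'' c)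
    (hx : epsilon x Δ = 0) (hy : epsilon y Δ' = 0) (hz : epsilon z Δ'' = 0) :
    star (star a b) c - star a (star b c) ∈ D.ideal p := by
  have h1 := hs.sub_rightOp_mem (hs.mem_paritySpan (ha.mem_paritySpan hx) (hb.mem_paritySpan hy))
    hc hz
  have h2 := hs.mem_ideal_left (ha.mem_paritySpan hx)
    (hs.sub_rightOp_mem (hb.mem_paritySpan hy) hc hz)
  have h3 := zsmul_mem (leftOp_rightOp_sub_mem (p := p) ha hb hc hx hy hz) (koszulSign j k)
  rw [← hs _ _ _ _ ha hx] at h3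
  rw [koszulSign_add_left] at h1
  rw [map_sub, map_zsmul] at h2
  convert sub_mem (sub_mem h1 h2) h3 using 1
  module

theorem assoc_mem (hs : D.IsStar p star) {i j k a b c} (ha : a ∈ D.paritySpan i)
    (hb : b ∈ D.paritySpan j) (hc : c ∈ D.paritySpan k) :
    star (star a b) c - star a (star b c) ∈ D.ideal p := by
  change a ∈ (D.ideal p).comap ((star.flip c).comp (star.flip b) - star.flip (star b c))
  refine Submodule.span_le.2 ?_ ha
  rintro a ⟨x, Δ, hx, ha⟩
  change b ∈ (D.ideal p).comap ((star.flip c).comp (star a) - (star a).comp (star.flip c))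
  refine Submodule.span_le.2 ?_ hb
  rintro b ⟨y, Δ', hy, hb⟩
  change c ∈ (D.ideal p).comap (star (star a b) - (star a).comp (star b))
  refine Submodule.span_le.2 ?_ hc
  rintro c ⟨z, Δ'', hz, hc⟩
  exact hs.assoc_mem_of_homog ha hb hc hx hy hz

/-- The residue of `z^(-p-1-m) (1+z)^p` is `binom(p, p+m)`, which is `1` for `m = 0` and `0`
otherwise; the equality holds before passing to the quotient. -/
theorem vac_star (hs : D.IsStar p star) (u : M) : star D.vac u = u := by
  rw [hs _ _ _ _ D.vac_homog EnergyOperator.epsilon_zero, leftOp_apply, sum_eq_single 0]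
  · rw [Ring.choose_zero_right, one_smul, zero_add]
    rw [D.res_eq_sum (N := p + 1) (fun j hj => by rw [D.vac_mode, if_neg (by push_cast; omega)]),
      sum_eq_single p]
    · rw [D.vac_mode, if_pos (by push_cast; ring), binomialSeries_coeff, Ring.choose_natCast]
      simp
    · intro j _ hj
      rw [D.vac_mode, if_neg (by omega), smul_zero]
    · simp
  · intro m _ hm
    rw [D.res_eq_sum (N := p + m + 1)
      (fun j hj => by rw [D.vac_mode, if_neg (by omega)]), sum_eq_single (p + m),
      zero_add, binomialSeries_coeff, Ring.choose_natCast, Nat.choose_eq_zero_of_lt (by omega)]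
    · simp
    · intro j _ hj
      rw [D.vac_mode, if_neg (by omega), smul_zero]
    · simp
  · simp

theorem sub_star_mem (hs : D.IsStar p star) {i j x y Δ Δ' a b} (ha : D.Homog i x Δ a)
    (hb : D.Homog j y Δ' b) (hx : epsilon x Δ = 0) (hy : epsilon y Δ' = 0) :
    star a b - koszulSign i j • star b a - D.adOp Δ a b ∈ D.ideal p := by
  rw [hs _ _ _ _ ha hx, hs _ _ _ _ hb hy]
  exact leftOp_sub_leftOp_mem ha hb hx hy

theorem star_vac (hs : D.IsStar p star) {i u} (hu : u ∈ D.paritySpan i) :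
    star u D.vac - u ∈ D.ideal p := by
  change u ∈ (D.ideal p).comap (star.flip D.vac - LinearMap.id)
  refine Submodule.span_le.2 ?_ hu
  rintro u ⟨x, Δ, hx, hu⟩
  have h := hs.sub_star_mem hu D.vac_homog hx EnergyOperator.epsilon_zero
  rw [koszulSign_comm, koszulSign_zero_left, one_smul, hs.vac_star, adOp,
    D.res_eq_sum (N := 0) (fun j _ => D.mode_vac _ _ (by omega)), range_zero, sum_empty,
    sub_zero] at h
  exact h

end IsStar

end ModeAlgebra
end

noncomputable section

/-! ### Vertex algebras -/

theorem paritySign_eq (i j : ZMod 2) : paritySign i j = ((koszulSign i j : ℤ) : ℂ) := by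
  simp [paritySign, koszulSign]

theorem iSup_zmod_two {L : Type*} [CompleteLattice L] (f : ZMod 2 → L) (i : ZMod 2) :
    ⨆ k, f k = f i ⊔ f (i + 1) := by
  refine le_antisymm (iSup_le fun k => ?_) (sup_le (le_iSup f i) (le_iSup f (i + 1)))
  have h : ∀ i k : ZMod 2, k = i ∨ k = i + 1 := by decide
  rcases h i k with rfl | rfl
  · exact le_sup_left
  · exact le_sup_right

theorem finsum_ite_cast_eq {M : Type*} [AddCommMonoid M] (f : ℕ → M) (k : ℤ) :
    (∑ᶠ j : ℕ, if k = j then f j else 0) = if 0 ≤ k then f k.toNat else 0 := by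
  rw [finsum_eq_single _ k.toNat fun j hj => if_neg (by omega)]
  split_ifs <;> first | rfl | omega

namespace VertexAlgebra

variable {V : Type*} [AddCommGroup V] [Module ℂ V] (A : VertexAlgebra V)

theorem parity_induction {q : V → Prop} (hp : ∀ i, ∀ a ∈ A.parity i, q a) (h0 : q 0)
    (hadd : ∀ a b, q a → q b → q (a + b)) (a : V) : q a := by
  have ha : a ∈ ⨆ i, A.parity i := by
    rw [A.parity_isInternal.submodule_iSup_eq_top]; trivial
  exact Submodule.iSup_induction _ (motive := q) ha hp h0 hadd

theorem disjoint_parity (i : ZMod 2) : Disjoint (A.parity i) (A.parity (i + 1)) :=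
  A.parity_isInternal.submodule_iSupIndep.pairwiseDisjoint (by revert i; decide)

theorem prod_commutator {i j : ZMod 2} {a b : V} (ha : a ∈ A.parity i) (hb : b ∈ A.parity j)
    (m n : ℤ) (c : V) :
    A.prod m a (A.prod n b c) - koszulSign i j • A.prod n b (A.prod m a c) =
      ∑ᶠ l : ℕ, Ring.choose m l • A.prod (m + n - l) (A.prod l a b) c := by
  have h := A.borcherds i j a b c m n 0 ha hb
  simp only [zero_add] at h
  rw [h, finsum_eq_single _ 0 fun l hl => by
    rw [Ring.choose_zero_pos ℤ (Nat.pos_of_ne_zero hl), mul_zero, zero_smul]]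
  simp [paritySign_eq, Int.cast_smul_eq_zsmul]

/-- The Borcherds identity with `b = vac` and `m = 0`: the vacuum axiom leaves at most one term in
each half of the sum. As `Y` is injective, this determines `a_(n) vac`, so the creation and
translation properties need not be axioms. -/
theorem prod_prod_vac (a : V) (n k : ℤ) (c : V) :
    A.prod k (A.prod n a A.vac) c =
      (if k ≤ -1 then ((-1) ^ (-1 - k).toNat * Ring.choose n (-1 - k).toNat) •
        A.prod (n + 1 + k) a c else 0) -
      n.negOnePow • (if 0 ≤ k + n + 1 then ((-1) ^ (k + n + 1).toNat *
        Ring.choose n (k + n + 1).toNat) • A.prod (k + n + 1) a c else 0) := by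
  revert a
  refine A.parity_induction (fun i a ha => ?_) (by simp) (fun a b h h' => by
    simp only [map_add, LinearMap.add_apply, h, h']
    split_ifs <;> simp only [smul_add, smul_zero, sub_zero, add_zero] <;> abel)
  have h := A.borcherds i 0 a A.vac c 0 k n ha A.vac_even
  rw [finsum_eq_single _ 0 fun l hl => by
    rw [Ring.choose_zero_pos ℤ (Nat.pos_of_ne_zero hl), zero_smul]] at h
  simp only [A.vacuum] at h
  have h1 : ∀ j : ℕ, ((-1 : ℤ) ^ j * Ring.choose n j) •
      (nthProduct A.Y (0 + n - j) a (if k + j = -1 then c else 0) -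
        (paritySign i 0 * (-1 : ℂ) ^ n) •
          (if k + n - j = -1 then nthProduct A.Y (0 + j) a c else 0)) =
      (if -1 - k = j then ((-1 : ℤ) ^ j * Ring.choose n j) • A.prod (n - j) a c else 0) -
      n.negOnePow • (if k + n + 1 = j then ((-1 : ℤ) ^ j * Ring.choose n j) • A.prod j a c
        else 0) := fun j => by
    have e1 : (k + j = -1) = (-1 - k = j) := by apply propext; omega
    have e2 : (k + n - j = -1) = (k + n + 1 = j) := by apply propext; omega
    have e3 : paritySign i 0 * (-1 : ℂ) ^ n = ((n.negOnePow : ℤ) : ℂ) := by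
      rw [paritySign, ZMod.val_zero, mul_zero, pow_zero, one_mul, Int.cast_negOnePow]
    rw [e3, Int.cast_smul_eq_zsmul]
    simp only [e1, e2, zero_add, Units.smul_def]
    split_ifs <;> simp only [smul_sub, map_zero, smul_zero, sub_zero, zero_sub, smul_neg,
      smul_comm ((-1 : ℤ) ^ j * Ring.choose n j) ((n.negOnePow : ℤˣ) : ℤ)]
  simp only [h1] at h
  have hfin : ∀ (t : ℤ) (f : ℕ → V),
      (Function.support fun j : ℕ => if t = j then f j else 0).Finite := fun t f =>
    (Set.finite_singleton t.toNat).subset fun j hj => by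
      by_contra hc
      exact hj (if_neg fun h => hc (by simp [h]))
  rw [finsum_sub_distrib (hfin _ _) ((hfin (k + n + 1) fun j =>
      ((-1 : ℤ) ^ j * Ring.choose n j) • A.prod j a c).subset fun j hj hc => hj (by
        simp only at hc ⊢; rw [hc, smul_zero])), ← smul_finsum' _ (hfin _ _), finsum_ite_cast_eq,
      finsum_ite_cast_eq] at h
  simp only [Ring.choose_zero_right, one_smul, zero_add, Nat.cast_zero, sub_zero, add_zero] at h
  rw [VertexAlgebra.prod, h]
  congr 1
  · by_cases hk : k ≤ -1
    · rw [if_pos hk, if_pos (by omega)]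
      rw [show n - ((-1 - k).toNat : ℤ) = n + 1 + k by omega]
    · rw [if_neg hk, if_neg (by omega)]
  · congr 1
    by_cases hk : 0 ≤ k + n + 1
    · rw [if_pos hk, if_pos hk, Int.toNat_of_nonneg hk]
    · rw [if_neg hk, if_neg hk]

theorem eq_of_prod_eq {a b : V} (h : ∀ (n : ℤ) (c : V), A.prod n a c = A.prod n b c) : a = b := by
  refine A.Y_injective ?_
  ext c n
  have h2 : ((HahnModule.of ℂ).symm (A.Y a c)).coeff (-(-n - 1) - 1) =
    ((HahnModule.of ℂ).symm (A.Y b c)).coeff (-(-n - 1) - 1) := h (-n - 1) c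
  rwa [show -(-n - 1) - 1 = n by ring] at h2

theorem prod_vac_of_nonneg {n : ℤ} (hn : 0 ≤ n) (a : V) : A.prod n a A.vac = 0 := by
  refine A.eq_of_prod_eq fun k c => ?_
  obtain ⟨n, rfl⟩ := Int.eq_ofNat_of_zero_le hn
  rw [prod_prod_vac, map_zero, LinearMap.zero_apply]
  by_cases h1 : k ≤ -1
  · by_cases h2 : 0 ≤ k + n + 1
    · obtain ⟨q, hq⟩ := Int.eq_ofNat_of_zero_le h2
      obtain ⟨r, rfl⟩ : ∃ r : ℕ, k = -1 - r := ⟨(-1 - k).toNat, by omega⟩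
      have hqr : n = q + r := by omega
      subst hqr
      rw [if_pos h1, if_pos h2, Units.smul_def, smul_smul, sub_eq_zero,
        show ((-1 - (-1 - r : ℤ))).toNat = r by omega,
        show (-1 - r + (q + r : ℕ) + 1 : ℤ).toNat = q by omega, Ring.choose_natCast,
        Ring.choose_natCast, Int.coe_negOnePow_natCast, Nat.choose_symm_add,
        show ((q + r : ℕ) : ℤ) + 1 + (-1 - r) = -1 - r + (q + r : ℕ) + 1 by ring]
      congr 1
      have h6 : (-1 : ℤ) ^ q * (-1) ^ q = 1 := by rw [← mul_pow]; simp
      rw [pow_add]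
      linear_combination (-(-1) ^ r * ((q + r).choose r : ℤ)) * h6
    · rw [if_neg h2, if_pos h1, Ring.choose_natCast, Nat.choose_eq_zero_of_lt (by omega)]
      simp
  · rw [if_neg h1]
    split_ifs
    · rw [Ring.choose_natCast, Nat.choose_eq_zero_of_lt (by omega)]
      simp
    · simp

theorem neg_one_pow_mul_choose_neg (r : ℤ) (j : ℕ) :
    (-1) ^ j * Ring.choose (-r) j = Ring.choose (r + j - 1) j := by
  have h6 : (-1 : ℤ) ^ j * (-1) ^ j = 1 := by rw [← mul_pow]; simp
  rw [Ring.choose_neg, Units.smul_def, smul_eq_mul, Int.coe_negOnePow_natCast, ← mul_assoc, h6,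
    one_mul]

theorem prod_neg_one_vac (a : V) : A.prod (-1) a A.vac = a := by
  refine A.eq_of_prod_eq fun k c => ?_
  have h : ∀ j : ℕ, (-1) ^ j * Ring.choose (-1 : ℤ) j = 1 := fun j => by
    rw [neg_one_pow_mul_choose_neg, add_sub_cancel_left, Ring.choose_natCast]
    simp
  rw [prod_prod_vac, h, h]
  by_cases h1 : k ≤ -1
  · rw [if_pos h1, if_neg (by omega)]
    simp
  · rw [if_neg h1, if_pos (by omega)]
    simp [Units.smul_def]

theorem prod_translation (n : ℤ) (a b : V) :
    A.prod n (A.prod (-2) a A.vac) b = (-n) • A.prod (n - 1) a b := by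
  have h : ∀ j : ℕ, (-1) ^ j * Ring.choose (-2 : ℤ) j = j + 1 := fun j => by
    rw [neg_one_pow_mul_choose_neg, show (2 : ℤ) + j - 1 = ((j + 1 : ℕ) : ℤ) by push_cast; ring,
      Ring.choose_natCast]
    simp
  rw [prod_prod_vac, h, h, show (-2 : ℤ) + 1 + n = n - 1 by ring,
    show n + (-2 : ℤ) + 1 = n - 1 by ring]
  have he : (-2 : ℤ).negOnePow = 1 := Int.negOnePow_even _ ⟨-1, by norm_num⟩
  rw [he, one_smul]
  by_cases h1 : n ≤ -1
  · rw [if_pos h1, if_neg (by omega), sub_zero]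
    congr 1
    omega
  · by_cases h2 : 0 ≤ n - 1
    · rw [if_neg h1, if_pos h2, zero_sub, ← neg_smul]
      congr 1
      omega
    · have : n = 0 := by omega
      subst this
      simp

theorem prod_skew {i j : ZMod 2} {a b : V} (ha : a ∈ A.parity i) (hb : b ∈ A.parity j) (n : ℤ) :
    ∑ᶠ l : ℕ, (-1 : ℤ) ^ l • A.prod (-1 - l) (A.prod (n + l) a b) A.vac =
      -((koszulSign i j * n.negOnePow) • A.prod n b a) := by
  -- With `c = vac`, `m = -1` and `k = 0`, every `b_(j) vac` vanishes and `a_(-1+j) vac` survives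
  -- only for `j = 0`, where it equals `a`.
  have h := A.borcherds i j a b A.vac (-1) 0 n ha hb
  have h1 : ∀ l : ℕ, Ring.choose (-1 : ℤ) l = (-1) ^ l := fun l => by
    rw [Ring.choose_neg, Units.smul_def, Int.coe_negOnePow_natCast, add_sub_cancel_left,
      Ring.choose_natCast]
    simp
  simp only [h1, add_zero] at h
  rw [h, finsum_eq_single _ 0 fun l hl => by
    have h2 := A.prod_vac_of_nonneg (n := 0 + l) (by omega) b
    have h3 := A.prod_vac_of_nonneg (n := -1 + l) (by omega) a
    rw [VertexAlgebra.prod] at h2 h3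
    rw [h2, h3]
    simp]
  have h2 := A.prod_vac_of_nonneg le_rfl b
  have h3 := A.prod_neg_one_vac a
  rw [VertexAlgebra.prod] at h2 h3
  have h4 : paritySign i j * (-1 : ℂ) ^ n = ((koszulSign i j * n.negOnePow : ℤ) : ℂ) := by
    rw [paritySign_eq]; push_cast; rw [Int.cast_negOnePow]
  rw [h4, Int.cast_smul_eq_zsmul]
  simp [h2, h3]

end VertexAlgebra


end

noncomputable section

open PowerSeries Finset

theorem algebraMap_real_hbarRing (r : ℝ) :
    algebraMap ℝ HbarRing r = algebraMap ℂ HbarRing (r : ℂ) := rfl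

namespace EnergyOperator

variable {Γ : AddSubgroup ℝ} {V : Type*} [AddCommGroup V] [Module ℂ V]
  {A : GradedVertexAlgebra Γ V} (E : EnergyOperator A)

/-! ### Homogeneous elements and parity -/

/-- The elements of parity `i`, degree `x` and conformal weight `Δ`. -/
def parityComponent (i : ZMod 2) (x : ModInt Γ) (Δ : ℝ) : Submodule ℂ V :=
  E.component x Δ ⊓ A.parity i

theorem component_eq_iSup (x : ModInt Γ) (Δ : ℝ) :
    E.component x Δ = ⨆ i, E.parityComponent i x Δ := by
  refine le_antisymm (fun a ha => ?_) (iSup_le fun i => inf_le_left)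
  have h := A.deg_super x
  rw [iSup_zmod_two _ 0] at h ⊢
  have ha1 := ha.1
  rw [SetLike.mem_coe, h] at ha1
  obtain ⟨b, hb, c, hc, rfl⟩ := Submodule.mem_sup.1 ha1
  have hH := Module.End.mem_eigenspace_iff.1 ha.2
  rw [map_add, smul_add] at hH
  -- Since `H` is even, this vector is both even and odd, hence zero: the even and odd parts of an
  -- eigenvector are eigenvectors.
  have h1 : E.H b - (Δ : ℂ) • b = -(E.H c - (Δ : ℂ) • c) := by
    rw [eq_neg_iff_add_eq_zero, sub_add_sub_comm, hH, sub_self]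
  have hb' : E.H b - (Δ : ℂ) • b ∈ A.parity 0 :=
    sub_mem (E.even 0 b hb.2) (Submodule.smul_mem _ _ hb.2)
  have hc' : E.H c - (Δ : ℂ) • c ∈ A.parity (0 + 1) :=
    sub_mem (E.even _ c hc.2) (Submodule.smul_mem _ _ hc.2)
  have h2 : E.H b - (Δ : ℂ) • b = 0 :=
    Submodule.disjoint_def.1 (A.disjoint_parity 0) _ hb' (by rw [h1]; exact neg_mem hc')
  have h3 : E.H c - (Δ : ℂ) • c = 0 := by rwa [h2, zero_eq_neg] at h1
  exact Submodule.mem_sup.2 ⟨b, ⟨⟨hb.1, Module.End.mem_eigenspace_iff.2 (sub_eq_zero.1 h2)⟩, hb.2⟩,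
    c, ⟨⟨hc.1, Module.End.mem_eigenspace_iff.2 (sub_eq_zero.1 h3)⟩, hc.2⟩, rfl⟩

theorem component_induction {x : ModInt Γ} {Δ : ℝ} {q : V → Prop}
    (hq : ∀ i, ∀ a ∈ E.parityComponent i x Δ, q a) (h0 : q 0)
    (hadd : ∀ a b, q a → q b → q (a + b)) {a : V} (ha : a ∈ E.component x Δ) : q a := by
  rw [component_eq_iSup] at ha
  exact Submodule.iSup_induction _ (motive := q) ha hq h0 hadd

/-- The span of the homogeneous elements of parity `i` with `ε = 0`. -/
def parityVGamma (i : ZMod 2) : Submodule ℂ V :=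
  ⨆ t : {t : ModInt Γ × ℝ // epsilon t.1 t.2 = 0}, E.parityComponent i t.1.1 t.1.2

theorem parityVGamma_le_parity (i : ZMod 2) : E.parityVGamma i ≤ A.parity i :=
  iSup_le fun _ => inf_le_right

theorem VGamma_eq_iSup : E.VGamma = ⨆ i, E.parityVGamma i := by
  simp only [VGamma, parityVGamma, component_eq_iSup]
  exact iSup_comm

theorem mem_parityVGamma {i : ZMod 2} {a : V} (ha : a ∈ E.VGamma) (hi : a ∈ A.parity i) :
    a ∈ E.parityVGamma i := by
  rw [VGamma_eq_iSup, iSup_zmod_two _ i] at ha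
  obtain ⟨b, hb, c, hc, rfl⟩ := Submodule.mem_sup.1 ha
  have h1 := E.parityVGamma_le_parity _ hb
  have h2 : c = 0 := Submodule.disjoint_def.1 (A.disjoint_parity i) c
    ((Submodule.add_mem_iff_right _ h1).1 hi) (E.parityVGamma_le_parity _ hc)
  rwa [h2, add_zero]

theorem parityVGamma_induction {i : ZMod 2} {q : V → Prop}
    (hq : ∀ x Δ a, epsilon x Δ = 0 → a ∈ E.parityComponent i x Δ → q a) (h0 : q 0)
    (hadd : ∀ a b, q a → q b → q (a + b)) {a : V} (ha : a ∈ E.parityVGamma i) : q a :=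
  Submodule.iSup_induction _ (motive := q) ha (fun t a ht => hq _ _ a t.2 ht) h0 hadd

theorem prod_mem_parityComponent {i j : ZMod 2} {x y : ModInt Γ} {Δ Δ' : ℝ} {a b : V} (n : ℤ)
    (ha : a ∈ E.parityComponent i x Δ) (hb : b ∈ E.parityComponent j y Δ') :
    A.prod n a b ∈ E.parityComponent (i + j) (x + y) (Δ + Δ' - n - 1) :=
  ⟨E.prod_mem_component n ha.1 hb.1, A.Y_parity i j a b n ha.2 hb.2⟩

/-! ### The rescaled modes -/

variable (A) in
/-- The rescaled modes `ħ ^ (n + 1) a_(n) b` on `ℂ[ħ, ħ⁻¹] ⊗ V`. -/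
def hbarMode (n : ℤ) :
    (HbarRing ⊗[ℂ] V) →ₗ[HbarRing] (HbarRing ⊗[ℂ] V) →ₗ[HbarRing] (HbarRing ⊗[ℂ] V) :=
  bilinExtend ((A.prod n).compr₂ (TensorProduct.mk ℂ HbarRing V (hbarPow (n + 1))))

theorem hbarMode_tmul (n : ℤ) (r s : HbarRing) (a b : V) :
    hbarMode A n (r ⊗ₜ a) (s ⊗ₜ b) = (r * s * hbarPow (n + 1)) ⊗ₜ A.prod n a b := by
  rw [hbarMode, bilinExtend_tmul]
  simp [TensorProduct.smul_tmul']

@[elab_as_elim]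
theorem tmul_induction {q : HbarRing ⊗[ℂ] V → Prop} (ht : ∀ r a, q (r ⊗ₜ a))
    (hadd : ∀ a b, q a → q b → q (a + b)) (u : HbarRing ⊗[ℂ] V) : q u :=
  TensorProduct.induction_on u (by simpa using ht 0 0) ht hadd

theorem hbarMode_tmul_vac (n : ℤ) (u : HbarRing ⊗[ℂ] V) {c : ℂ}
    (h : ∀ a : V, A.prod n a A.vac = c • a) :
    hbarMode A n u (1 ⊗ₜ A.vac) = c • (hbarPow (n + 1) • u) := by
  refine tmul_induction (fun r a => ?_) (fun a b h h' => by
    rw [map_add, LinearMap.add_apply, h, h', smul_add, smul_add]) u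
  rw [hbarMode_tmul, h, mul_one, TensorProduct.tmul_smul,
    TensorProduct.smul_tmul' (hbarPow (n + 1)), smul_eq_mul, mul_comm]

theorem finsum_tmul {f : ℕ → V} {N : ℕ} (hf : ∀ l, N ≤ l → f l = 0) (r : HbarRing) :
    r ⊗ₜ[ℂ] (∑ᶠ l, f l) = ∑ᶠ l, r ⊗ₜ[ℂ] f l := by
  have hs : Function.support f ⊆ (range N : Finset ℕ) := fun l hl => by
    by_contra hc
    simp only [coe_range, Set.mem_Iio, not_lt] at hc
    exact hl (hf l hc)
  have hs' : (Function.support fun l => r ⊗ₜ[ℂ] f l) ⊆ (range N : Finset ℕ) := fun l hl =>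
    hs fun hc => hl (by simp only [hc, TensorProduct.tmul_zero])
  rw [finsum_eq_sum_of_support_subset _ hs, finsum_eq_sum_of_support_subset _ hs',
    TensorProduct.tmul_sum]

theorem hbarPow_mul (m n : ℤ) : hbarPow m * hbarPow n = hbarPow (m + n) :=
  (LaurentPolynomial.T_add m n).symm

theorem hbarMode_commutator {i j : ZMod 2} {a b : V} (ha : a ∈ A.parity i) (hb : b ∈ A.parity j)
    (m n : ℤ) (r s t : HbarRing) (c : V) :
    hbarMode A m (r ⊗ₜ a) (hbarMode A n (s ⊗ₜ b) (t ⊗ₜ c)) -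
      koszulSign i j • hbarMode A n (s ⊗ₜ b) (hbarMode A m (r ⊗ₜ a) (t ⊗ₜ c)) =
      ∑ᶠ l : ℕ, Ring.choose m l • hbarMode A (m + n - l) (hbarMode A l (r ⊗ₜ a) (s ⊗ₜ b))
        (t ⊗ₜ c) := by
  simp only [hbarMode_tmul]
  obtain ⟨N, hN⟩ := A.prod_eq_zero_of_large a b
  have hf : ∀ l : ℕ, N.toNat ≤ l →
      Ring.choose m l • A.prod (m + n - l) (A.prod l a b) c = 0 := fun l hl => by
    rw [hN l (by omega), map_zero, LinearMap.zero_apply, smul_zero]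
  have h := finsum_tmul hf (r * s * t * hbarPow (m + n + 2))
  have e1 : hbarPow (m + n + 2) = hbarPow (m + 1) * hbarPow (n + 1) := by
    rw [hbarPow_mul]; congr 1; ring
  rw [← A.prod_commutator ha hb, TensorProduct.tmul_sub, TensorProduct.tmul_smul] at h
  have h1 : r * (s * t * hbarPow (n + 1)) * hbarPow (m + 1) = r * s * t * hbarPow (m + n + 2) := by
    rw [e1]; ring
  have h2 : s * (r * t * hbarPow (m + 1)) * hbarPow (n + 1) = r * s * t * hbarPow (m + n + 2) := by
    rw [e1]; ring
  rw [h1, h2, h]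
  refine finsum_congr fun l => ?_
  have e2 : hbarPow (m + n + 2) = hbarPow (l + 1) * hbarPow (m + n - l + 1) := by
    rw [hbarPow_mul]; congr 1; ring
  rw [TensorProduct.tmul_smul, e2]
  congr 2
  ring

theorem hbarMode_skew {i j : ZMod 2} {a b : V} (ha : a ∈ A.parity i) (hb : b ∈ A.parity j)
    (n : ℤ) (r s : HbarRing) :
    ∑ᶠ l : ℕ, (-1 : ℤ) ^ l •
      hbarMode A (-1 - l) (hbarMode A (n + l) (r ⊗ₜ a) (s ⊗ₜ b)) (1 ⊗ₜ A.vac) =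
      -((koszulSign i j * n.negOnePow) • hbarMode A n (s ⊗ₜ b) (r ⊗ₜ a)) := by
  simp only [hbarMode_tmul]
  obtain ⟨N, hN⟩ := A.prod_eq_zero_of_large a b
  have hf : ∀ l : ℕ, (N - n).toNat ≤ l →
      (-1 : ℤ) ^ l • A.prod (-1 - l) (A.prod (n + l) a b) A.vac = 0 := fun l hl => by
    rw [hN (n + l) (by omega), map_zero, LinearMap.zero_apply, smul_zero]
  have h := finsum_tmul hf (s * r * hbarPow (n + 1))
  rw [A.prod_skew ha hb, TensorProduct.tmul_neg, TensorProduct.tmul_smul] at h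
  rw [h]
  refine finsum_congr fun l => ?_
  have e : hbarPow (n + 1) = hbarPow (n + l + 1) * hbarPow (-1 - l + 1) := by
    rw [hbarPow_mul]; congr 1; ring
  rw [TensorProduct.tmul_smul, e]
  congr 2
  ring

/-- The rescaled vertex algebra `ℂ[ħ, ħ⁻¹] ⊗ V`. -/
def modeAlgebra : ModeAlgebra Γ HbarRing (HbarRing ⊗[ℂ] V) where
  mode := hbarMode A
  mode_large a b := by
    refine tmul_induction (fun r a => ?_) (fun a a' h h' => ?_) a
    · refine tmul_induction (fun s b => ?_) (fun b b' h h' => ?_) b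
      · obtain ⟨N, hN⟩ := A.prod_eq_zero_of_large a b
        exact ⟨N, fun n hn => by rw [hbarMode_tmul, hN n hn, TensorProduct.tmul_zero]⟩
      · obtain ⟨N, hN⟩ := h
        obtain ⟨N', hN'⟩ := h'
        exact ⟨max N N', fun n hn => by
          rw [map_add, hN n (le_trans (le_max_left _ _) hn),
            hN' n (le_trans (le_max_right _ _) hn), add_zero]⟩
    · obtain ⟨N, hN⟩ := h
      obtain ⟨N', hN'⟩ := h'
      exact ⟨max N N', fun n hn => by
        rw [map_add, LinearMap.add_apply, hN n (le_trans (le_max_left _ _) hn),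
          hN' n (le_trans (le_max_right _ _) hn), add_zero]⟩
  -- Arbitrary Laurent coefficients are admitted, with `ħ` of weight zero, because the rescaled
  -- modes multiply by powers of `ħ`.
  Homog i x Δ u := ∃ (r : HbarRing) (a : V), a ∈ E.parityComponent i x Δ ∧ u = r ⊗ₜ a
  mode_homog := by
    rintro i j x y Δ Δ' _ _ n ⟨r, a, ha, rfl⟩ ⟨s, b, hb, rfl⟩
    exact ⟨_, _, E.prod_mem_parityComponent n ha hb, hbarMode_tmul n r s a b⟩
  vac := 1 ⊗ₜ A.vac
  vac_homog := ⟨1, A.vac, ⟨E.vac_mem_component, A.vac_even⟩, rfl⟩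
  vac_mode n u := by
    refine tmul_induction (fun r a => ?_) (fun a b h h' => by
      rw [map_add, h, h']; split_ifs <;> simp) u
    rw [hbarMode_tmul, VertexAlgebra.prod, A.vacuum]
    split_ifs with h
    · subst h; simp [LaurentPolynomial.T_zero]
    · simp
  mode_vac n u hn := by
    rw [hbarMode_tmul_vac n u (c := 0) fun a => by rw [zero_smul, A.prod_vac_of_nonneg hn],
      zero_smul]
  creation u := by
    rw [hbarMode_tmul_vac (-1) u (c := 1) fun a => by rw [one_smul, A.prod_neg_one_vac], one_smul]
    simp [LaurentPolynomial.T_zero]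
  commutator := by
    rintro i j k x y z Δ Δ' Δ'' _ _ _ m n ⟨r, a, ha, rfl⟩ ⟨s, b, hb, rfl⟩ ⟨t, c, hc, rfl⟩
    exact hbarMode_commutator ha.2 hb.2 m n r s t c
  skew := by
    rintro i j x y Δ Δ' _ _ n ⟨r, a, ha, rfl⟩ ⟨s, b, hb, rfl⟩
    exact hbarMode_skew ha.2 hb.2 n r s
  translation n u v := by
    refine tmul_induction (fun r a => ?_) (fun a b h h' => by
      rw [map_add, LinearMap.add_apply, map_add, LinearMap.add_apply, h, h', map_add,
        LinearMap.add_apply, smul_add]) u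
    refine tmul_induction (fun s b => ?_) (fun a b h h' => by
      rw [map_add, h, h', map_add, smul_add]) v
    rw [hbarMode_tmul, hbarMode_tmul, hbarMode_tmul, A.prod_translation, TensorProduct.tmul_smul]
    have e : hbarPow (n - 1 + 1) = hbarPow (-2 + 1) * hbarPow (n + 1) := by
      rw [hbarPow_mul]; congr 1; ring
    rw [e]
    congr 2
    ring

end EnergyOperator
end

noncomputable section

open PowerSeries Finset

namespace EnergyOperator

variable {Γ : AddSubgroup ℝ} {V : Type*} [AddCommGroup V] [Module ℂ V]
  {A : GradedVertexAlgebra Γ V} (E : EnergyOperator A)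

/-! ### Comparison of the products -/

theorem modeAlgebra_mode (n : ℤ) : E.modeAlgebra.mode n = hbarMode A n := rfl

theorem homog_tmul {i : ZMod 2} {x : ModInt Γ} {Δ : ℝ} {a : V} (r : HbarRing)
    (ha : a ∈ E.parityComponent i x Δ) : E.modeAlgebra.Homog i x Δ (r ⊗ₜ a) := ⟨r, a, ha, rfl⟩

/-- The rescaling leaves the single factor `ħ^(n+1)`. For `n = -p-1-m` it is the `ħ^(-p-m)` in the
definition of `*_p`; for `n = 0` it is the `ħ` in front of the bracket. -/
theorem res_tmul (n : ℤ) (s : ℝ) (r t : HbarRing) (a b : V) :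
    E.modeAlgebra.res n (binomialSeries HbarRing s) (r ⊗ₜ a) (t ⊗ₜ b) =
      (r * t * hbarPow (n + 1)) • A.residueProd s n a b := by
  rw [ModeAlgebra.res_apply, VertexAlgebra.residueProd_apply,
    smul_finsum' _ (A.residueProd_support s n a b)]
  refine finsum_congr fun j => ?_
  have e : hbarPow (n + j + 1) = hbarPow (n + 1) * hbarPow j := by
    rw [hbarPow_mul]; congr 1; ring
  rw [modeAlgebra_mode, hbarMode_tmul, binomialSeries_coeff, Algebra.smul_def, mul_one,
    algebraMap_real_hbarRing, algebraMap_smul, TensorProduct.tmul_smul, smul_comm _ (_ : ℂ), e,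
    TensorProduct.smul_tmul' (r * t * hbarPow (n + 1)), smul_eq_mul, mul_assoc (r * t)]

/-- The bilinear extension of `*_p` to `ℂ[ħ, ħ⁻¹] ⊗ V`. -/
def hbarStar (p : ℕ) :
    (HbarRing ⊗[ℂ] V) →ₗ[HbarRing] (HbarRing ⊗[ℂ] V) →ₗ[HbarRing] (HbarRing ⊗[ℂ] V) :=
  bilinExtend (E.starBase p)

theorem gammaIndex_eq {x : ModInt Γ} {Δ : ℝ} (h : epsilon x Δ = 0) : gammaIndex x Δ = Δ := by
  rw [gammaIndex, h, add_zero]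

theorem isStar_hbarStar (p : ℕ) : E.modeAlgebra.IsStar p (E.hbarStar p) := by
  rintro i x Δ _ ⟨r, a, ha, rfl⟩ hx
  refine LinearMap.ext fun u => ?_
  refine tmul_induction (fun t b => ?_) (fun b b' h h' => by rw [map_add, map_add, h, h']) u
  rw [hbarStar, bilinExtend_tmul, ModeAlgebra.leftOp_apply, starBase, LinearMap.sum_apply,
    LinearMap.sum_apply, smul_sum]
  refine sum_congr rfl fun m _ => ?_
  rw [LinearMap.smul_apply, LinearMap.smul_apply, LinearMap.smul_apply, LinearMap.smul_apply,
    sqProd, E.extendLinearly_apply _ ha.1, res_tmul, gammaIndex_eq hx, smul_comm, smul_smul,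
    show -(p : ℤ) - 1 - m + 1 = -(p : ℤ) - m by ring]

theorem adOp_tmul {i : ZMod 2} {x : ModInt Γ} {Δ : ℝ} {a : V} (ha : a ∈ E.parityComponent i x Δ)
    (hx : epsilon x Δ = 0) (b : V) :
    E.modeAlgebra.adOp Δ (1 ⊗ₜ a) (1 ⊗ₜ b) = hbarPow 1 • E.bracket a b := by
  rw [ModeAlgebra.adOp, res_tmul, bracket, E.extendLinearly_apply _ ha.1, gammaIndex_eq hx]
  simp

/-! ### Comparison of the ideals -/

theorem mem_of_hbarPow_smul_mem {S : Submodule HbarRing (HbarRing ⊗[ℂ] V)} {n : ℤ}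
    {u : HbarRing ⊗[ℂ] V} (h : hbarPow n • u ∈ S) : u ∈ S := by
  have := S.smul_mem (hbarPow (-n)) h
  rwa [smul_smul, hbarPow_mul, neg_add_cancel, hbarPow, LaurentPolynomial.T_zero, one_smul] at this

theorem deriv_tmul (Δ : ℝ) {r : HbarRing} {a : V} (ha : E.H a = (Δ : ℂ) • a) :
    E.modeAlgebra.mode (-2) (r ⊗ₜ a) E.modeAlgebra.vac + algebraMap ℝ HbarRing Δ • (r ⊗ₜ a) =
      (r * hbarPow (-1)) • (1 ⊗ₜ A.translation a + hbarPow 1 ⊗ₜ E.H a) := by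
  have h1 : E.modeAlgebra.mode (-2) (r ⊗ₜ a) E.modeAlgebra.vac =
      (r * 1 * hbarPow (-2 + 1)) ⊗ₜ A.prod (-2) a A.vac := hbarMode_tmul _ _ _ _ _
  have h2 : A.translation a = A.prod (-2) a A.vac := rfl
  have h3 : r * hbarPow (-1) * hbarPow 1 = r := by
    rw [mul_assoc, hbarPow_mul, neg_add_cancel, hbarPow, LaurentPolynomial.T_zero, mul_one]
  rw [h1, ha, smul_add, TensorProduct.smul_tmul' (r * hbarPow (-1)),
    TensorProduct.smul_tmul' (r * hbarPow (-1)), h2, smul_eq_mul, smul_eq_mul, h3,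
    algebraMap_real_hbarRing, algebraMap_smul, TensorProduct.tmul_smul, mul_one, mul_one]
  rfl

/-- The generators of either span are Laurent multiples of those of the other, once they are split
by parity and weight: `ħ⁻¹ T + H = ħ⁻¹ (T + ħ H)`, and the residues differ by `ħ^(n+1)`.
Invertibility of `ħ` is what makes the two spans equal. -/
theorem span_jGenerators (p : ℕ) :
    Submodule.span HbarRing (E.jGenerators₁ ∪ E.jGenerators₂ p) = E.modeAlgebra.ideal p := by
  refine le_antisymm (Submodule.span_le.2 ?_) (Submodule.span_le.2 ?_)
  · rintro u (⟨a, ha, rfl⟩ | ⟨x, y, Δ, Δ', a, b, ha, hb, h, rfl⟩)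
    · refine E.VGamma_induction (q := fun a => 1 ⊗ₜ A.translation a + hbarPow 1 ⊗ₜ E.H a
        ∈ E.modeAlgebra.ideal p) (fun x Δ a hx ha => ?_) (by simp) (fun a b h h' => ?_) ha
      · refine E.component_induction (q := fun a => 1 ⊗ₜ A.translation a + hbarPow 1 ⊗ₜ E.H a
          ∈ E.modeAlgebra.ideal p) (fun i a ha => ?_) (by simp) (fun a b h h' => ?_) ha
        · refine mem_of_hbarPow_smul_mem (n := -1) ?_
          have h1 := E.deriv_tmul Δ (r := 1) (Module.End.mem_eigenspace_iff.1 ha.1.2)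
          rw [one_mul] at h1
          rw [← h1]
          exact Submodule.subset_span (Or.inl ⟨i, x, Δ, _, E.homog_tmul 1 ha, hx, rfl⟩)
        · rw [map_add, map_add, TensorProduct.tmul_add, TensorProduct.tmul_add,
            add_add_add_comm]
          exact add_mem h h'
      · rw [map_add, map_add, TensorProduct.tmul_add, TensorProduct.tmul_add, add_add_add_comm]
        exact add_mem h h'
    · set n := -2 * (p : ℤ) - 2 + chi x Δ y Δ' with hn
      refine E.component_induction (q := fun a => E.sqProd p n a b ∈ E.modeAlgebra.ideal p)
        (fun i a ha => ?_) (by simp)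
        (fun a b h h' => by rw [map_add, LinearMap.add_apply]; exact add_mem h h') ha
      refine E.component_induction (q := fun b => E.sqProd p n a b ∈ E.modeAlgebra.ideal p)
        (fun j b hb => ?_) (by simp) (fun a b h h' => by rw [map_add]; exact add_mem h h') hb
      refine mem_of_hbarPow_smul_mem (n := n + 1) ?_
      have h1 := E.res_tmul n (gammaIndex x Δ + p) 1 1 a b
      rw [one_mul, one_mul] at h1
      rw [sqProd, E.extendLinearly_apply _ ha.1, ← h1]
      exact Submodule.subset_span (Or.inr ⟨i, j, x, y, Δ, Δ', _, _, E.homog_tmul 1 ha,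
        E.homog_tmul 1 hb, h, rfl⟩)
  · rintro u (⟨i, x, Δ, _, ⟨r, a, ha, rfl⟩, hx, rfl⟩ |
      ⟨i, j, x, y, Δ, Δ', _, _, ⟨r, a, ha, rfl⟩, ⟨t, b, hb, rfl⟩, h, rfl⟩)
    · rw [E.deriv_tmul Δ (Module.End.mem_eigenspace_iff.1 ha.1.2)]
      exact Submodule.smul_mem _ _ (Submodule.subset_span
        (Or.inl ⟨a, E.component_le_VGamma hx ha.1, rfl⟩))
    · rw [res_tmul]
      refine Submodule.smul_mem _ _ (Submodule.subset_span
        (Or.inr ⟨x, y, Δ, Δ', a, b, ha.1, hb.1, h, ?_⟩))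
      rw [sqProd, E.extendLinearly_apply _ ha.1]

theorem mem_J {p : ℕ} {u : E.VGammaHbar} : u ∈ E.J p ↔ E.toHbar u ∈ E.modeAlgebra.ideal p := by
  rw [J, Submodule.mem_comap, span_jGenerators]

theorem ideal_le_range (p : ℕ) : E.modeAlgebra.ideal p ≤ LinearMap.range E.toHbar := by
  rw [← span_jGenerators]
  exact Submodule.span_le.2 (E.jGenerators_subset p)

theorem tmul_mem_paritySpan {i : ZMod 2} {a : V} (r : HbarRing) (ha : a ∈ E.parityVGamma i) :
    r ⊗ₜ a ∈ E.modeAlgebra.paritySpan i :=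
  E.parityVGamma_induction (q := fun a => r ⊗ₜ a ∈ E.modeAlgebra.paritySpan i)
    (fun _ _ _ hx ha => (E.homog_tmul r ha).mem_paritySpan hx) (by simp)
    (fun a b h h' => by rw [TensorProduct.tmul_add]; exact add_mem h h') ha

theorem toHbar_induction {q : HbarRing ⊗[ℂ] V → Prop}
    (hq : ∀ i, ∀ u ∈ E.modeAlgebra.paritySpan i, q u) (h0 : q 0)
    (hadd : ∀ a b, q a → q b → q (a + b)) (u : E.VGammaHbar) : q (E.toHbar u) := by
  have hu : E.toHbar u ∈ ⨆ i, E.modeAlgebra.paritySpan i := by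
    induction u using TensorProduct.induction_on with
    | zero => simp
    | add u v hu hv => rw [map_add]; exact add_mem hu hv
    | tmul r a =>
      rw [toHbar_tmul]
      have ha := E.VGamma_eq_iSup.le a.2
      exact Submodule.iSup_induction _ (motive := fun a => r ⊗ₜ a ∈ _) ha
        (fun i a ha => le_iSup E.modeAlgebra.paritySpan i (E.tmul_mem_paritySpan r ha)) (by simp)
        (fun a b h h' => by rw [TensorProduct.tmul_add]; exact add_mem h h')
  exact Submodule.iSup_induction _ (motive := q) hu hq h0 hadd

/-! ### Transfer to `V_{Γ, ħ}` and its quotient. -/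

theorem toHbar_star_eq (p : ℕ) (u v : E.VGammaHbar) :
    E.toHbar (E.star p u v) = E.hbarStar p (E.toHbar u) (E.toHbar v) := E.toHbar_star p u v

theorem star_mem_J_left (p : ℕ) {u : E.VGammaHbar} (hu : u ∈ E.J p) (v : E.VGammaHbar) :
    E.star p v u ∈ E.J p := by
  rw [mem_J, toHbar_star_eq]
  exact E.toHbar_induction (q := fun v => E.hbarStar p v (E.toHbar u) ∈ E.modeAlgebra.ideal p)
    (fun i v hv => (E.isStar_hbarStar p).mem_ideal_left hv (E.mem_J.1 hu)) (by simp)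
    (fun a b h h' => by rw [map_add, LinearMap.add_apply]; exact add_mem h h') v

theorem star_mem_J_right (p : ℕ) {u : E.VGammaHbar} (hu : u ∈ E.J p) (v : E.VGammaHbar) :
    E.star p u v ∈ E.J p := by
  rw [mem_J, toHbar_star_eq]
  exact E.toHbar_induction (q := fun v => E.hbarStar p (E.toHbar u) v ∈ E.modeAlgebra.ideal p)
    (fun i v hv => (E.isStar_hbarStar p).mem_ideal_right hv (E.mem_J.1 hu)) (by simp)
    (fun a b h h' => by rw [map_add]; exact add_mem h h') v

theorem star_assoc_mem_J (p : ℕ) (u v w : E.VGammaHbar) :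
    E.star p (E.star p u v) w - E.star p u (E.star p v w) ∈ E.J p := by
  rw [mem_J, map_sub, toHbar_star_eq, toHbar_star_eq, toHbar_star_eq, toHbar_star_eq]
  set s := E.hbarStar p
  refine E.toHbar_induction (q := fun u => s (s u (E.toHbar v)) (E.toHbar w) -
    s u (s (E.toHbar v) (E.toHbar w)) ∈ E.modeAlgebra.ideal p) (fun i u hu => ?_) (by simp)
    (fun a b h h' => by
      simp only [map_add, LinearMap.add_apply, add_sub_add_comm]; exact add_mem h h') u
  refine E.toHbar_induction (q := fun v => s (s u v) (E.toHbar w) -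
    s u (s v (E.toHbar w)) ∈ E.modeAlgebra.ideal p) (fun j v hv => ?_) (by simp)
    (fun a b h h' => by
      simp only [map_add, LinearMap.add_apply, add_sub_add_comm]; exact add_mem h h') v
  refine E.toHbar_induction (q := fun w => s (s u v) w - s u (s v w) ∈ E.modeAlgebra.ideal p)
    (fun k w hw => (E.isStar_hbarStar p).assoc_mem hu hv hw) (by simp)
    (fun a b h h' => by
      simp only [map_add, add_sub_add_comm]; exact add_mem h h') w

theorem vacuum_star (p : ℕ) (u : E.VGammaHbar) : E.star p E.vacuum u = u := by
  apply E.toHbar_injective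
  rw [toHbar_star_eq]
  exact (E.isStar_hbarStar p).vac_star _

theorem star_vacuum_sub_mem_J (p : ℕ) (u : E.VGammaHbar) : E.star p u E.vacuum - u ∈ E.J p := by
  rw [mem_J, map_sub, toHbar_star_eq]
  exact E.toHbar_induction (q := fun u => E.hbarStar p u (E.toHbar E.vacuum) - u
    ∈ E.modeAlgebra.ideal p) (fun i u hu => (E.isStar_hbarStar p).star_vac hu) (by simp)
    (fun a b h h' => by
      rw [map_add, LinearMap.add_apply, add_sub_add_comm]; exact add_mem h h') u

theorem paritySpan_le (i : ZMod 2) :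
    E.modeAlgebra.paritySpan i ≤ (E.parityHbar i).map E.toHbar := by
  refine Submodule.span_le.2 ?_
  rintro _ ⟨x, Δ, hx, r, a, ha, rfl⟩
  refine ⟨r ⊗ₜ ⟨a, E.component_le_VGamma hx ha.1⟩, ?_, rfl⟩
  rw [SetLike.mem_coe, parityHbar, Submodule.mem_comap, toHbar_tmul]
  exact Submodule.tmul_mem_baseChange_of_mem r ha.2

theorem J_eq_iSup (p : ℕ) : E.J p = ⨆ i : ZMod 2, E.J p ⊓ E.parityHbar i := by
  refine le_antisymm (fun u hu => ?_) (iSup_le fun i => inf_le_left)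
  have h1 : E.modeAlgebra.ideal p ≤ (⨆ i : ZMod 2, E.J p ⊓ E.parityHbar i).map E.toHbar := by
    rw [ModeAlgebra.ideal_eq_iSup]
    refine iSup_le fun i w hw => ?_
    obtain ⟨v, hv, rfl⟩ := E.paritySpan_le i hw.2
    exact ⟨v, le_iSup (fun i : ZMod 2 => E.J p ⊓ E.parityHbar i) i ⟨E.mem_J.2 hw.1, hv⟩, rfl⟩
  obtain ⟨v, hv, he⟩ := h1 (E.mem_J.1 hu)
  rwa [← E.toHbar_injective he]

theorem hbarStar_sub_mem (p : ℕ) {i j : ZMod 2} {a b : V} (ha : a ∈ E.parityVGamma i)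
    (hb : b ∈ E.parityVGamma j) :
    E.hbarStar p (1 ⊗ₜ a) (1 ⊗ₜ b) - koszulSign i j • E.hbarStar p (1 ⊗ₜ b) (1 ⊗ₜ a) -
      hbarPow 1 • E.bracket a b ∈ E.modeAlgebra.ideal p := by
  set s := E.hbarStar p
  refine E.parityVGamma_induction (q := fun a => s (1 ⊗ₜ a) (1 ⊗ₜ b) -
    koszulSign i j • s (1 ⊗ₜ b) (1 ⊗ₜ a) - hbarPow 1 • E.bracket a b ∈ E.modeAlgebra.ideal p)
    (fun x Δ a hx ha => ?_) (by simp) (fun a a' h h' => ?_) ha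
  · refine E.parityVGamma_induction (q := fun b => s (1 ⊗ₜ a) (1 ⊗ₜ b) -
      koszulSign i j • s (1 ⊗ₜ b) (1 ⊗ₜ a) - hbarPow 1 • E.bracket a b ∈ E.modeAlgebra.ideal p)
      (fun y Δ' b hy hb => ?_) (by simp) (fun b b' h h' => ?_) hb
    · rw [← E.adOp_tmul ha hx]
      exact (E.isStar_hbarStar p).sub_star_mem (E.homog_tmul 1 ha) (E.homog_tmul 1 hb) hx hy
    · convert add_mem h h' using 1
      simp only [TensorProduct.tmul_add, map_add, LinearMap.add_apply, smul_add]
      abel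
  · convert add_mem h h' using 1
    simp only [TensorProduct.tmul_add, map_add, LinearMap.add_apply, smul_add]
    abel

theorem exists_star_sub_eq (p : ℕ) {i j : ZMod 2} (a b : E.VGamma) (ha : (a : V) ∈ A.parity i)
    (hb : (b : V) ∈ A.parity j) : ∃ c ∈ E.J p,
      E.toHbar (E.star p (1 ⊗ₜ a) (1 ⊗ₜ b) - paritySign i j • E.star p (1 ⊗ₜ b) (1 ⊗ₜ a)) =
        hbarPow 1 • E.bracket (a : V) (b : V) + E.toHbar c := by
  have h := E.hbarStar_sub_mem p (E.mem_parityVGamma a.2 ha) (E.mem_parityVGamma b.2 hb)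
  -- The bracket takes values in `ℂ[ħ, ħ⁻¹] ⊗ V`, so the congruence is obtained there; its error
  -- term comes from `V_{Γ, ħ}` because all generators of the ideal do.
  obtain ⟨c, hc⟩ := E.ideal_le_range p h
  refine ⟨c, E.mem_J.2 (hc ▸ h), ?_⟩
  have e : (((koszulSign i j : ℤ) : ℂ) • E.star p (1 ⊗ₜ b) (1 ⊗ₜ a) : E.VGammaHbar) =
      koszulSign i j • E.star p (1 ⊗ₜ b) (1 ⊗ₜ a) := by
    match_scalars
    simp
  rw [hc, add_sub_cancel, paritySign_eq, e, map_sub, map_zsmul,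
    toHbar_star_eq, toHbar_star_eq, toHbar_tmul, toHbar_tmul]

/-- The product on the quotient. -/
def zhuMul (p : ℕ) : E.Zhu p →ₗ[HbarRing] E.Zhu p →ₗ[HbarRing] E.Zhu p :=
  (E.J p).liftQ
    { toFun := fun u => (E.J p).mapQ (E.J p) (E.star p u) fun _ hv => E.star_mem_J_left p hv u
      map_add' := fun u v => Submodule.linearMap_qext _ (LinearMap.ext fun w => by simp)
      map_smul' := fun r u => Submodule.linearMap_qext _ (LinearMap.ext fun w => by simp) }
    fun u hu => LinearMap.mem_ker.2 (Submodule.linearMap_qext _ (LinearMap.ext fun w => by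
      simpa using E.star_mem_J_right p hu w))

theorem zhuMul_mkQ (p : ℕ) (u v : E.VGammaHbar) :
    E.zhuMul p ((E.J p).mkQ u) ((E.J p).mkQ v) = (E.J p).mkQ (E.star p u v) := rfl

end EnergyOperator

end

theorem mainTheorem4 {V : Type*} [AddCommGroup V] [Module ℂ V] (Γ : AddSubgroup ℝ)
    (hΓ : (1 : ℝ) ∈ Γ) (A : GradedVertexAlgebra Γ V) (E : EnergyOperator A) (p : ℕ) :
    -- `J` is a two-sided ideal of `(V_{Γ, ħ}, *_p)`, compatible with the parity
    (∀ u ∈ E.J p, ∀ v : E.VGammaHbar, E.star p u v ∈ E.J p ∧ E.star p v u ∈ E.J p) ∧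
    E.J p = ⨆ i : ZMod 2, E.J p ⊓ E.parityHbar i ∧
    -- the skew-symmetry formula
    (∀ (i j : ZMod 2) (a b : E.VGamma), (a : V) ∈ A.parity i → (b : V) ∈ A.parity j →
      ∃ c ∈ E.J p,
        E.toHbar (E.star p (1 ⊗ₜ a) (1 ⊗ₜ b) - paritySign i j • E.star p (1 ⊗ₜ b) (1 ⊗ₜ a)) =
          hbarPow 1 • E.bracket (a : V) (b : V) + E.toHbar c) ∧
    -- the product descends to the quotient, where it is associative with unit the vacuum
    (∃ mul : E.Zhu p →ₗ[HbarRing] E.Zhu p →ₗ[HbarRing] E.Zhu p,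
      (∀ u v : E.VGammaHbar,
        mul ((E.J p).mkQ u) ((E.J p).mkQ v) = (E.J p).mkQ (E.star p u v)) ∧
      (∀ u v w : E.Zhu p, mul (mul u v) w = mul u (mul v w)) ∧
      (∀ u : E.Zhu p, mul ((E.J p).mkQ E.vacuum) u = u ∧ mul u ((E.J p).mkQ E.vacuum) = u)) := by
  refine ⟨fun u hu v => ⟨E.star_mem_J_right p hu v, E.star_mem_J_left p hu v⟩, E.J_eq_iSup p,
    fun i j a b ha hb => E.exists_star_sub_eq p a b ha hb, E.zhuMul p, E.zhuMul_mkQ p, ?_, ?_⟩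
  · intro u v w
    obtain ⟨u, rfl⟩ := (E.J p).mkQ_surjective u
    obtain ⟨v, rfl⟩ := (E.J p).mkQ_surjective v
    obtain ⟨w, rfl⟩ := (E.J p).mkQ_surjective w
    simp only [E.zhuMul_mkQ]
    exact (Submodule.Quotient.eq _).2 (E.star_assoc_mem_J p u v w)
  · intro u
    obtain ⟨u, rfl⟩ := (E.J p).mkQ_surjective u
    rw [E.zhuMul_mkQ, E.zhuMul_mkQ, E.vacuum_star]
    exact ⟨rfl, (Submodule.Quotient.eq _).2 (E.star_vacuum_sub_mem_J p u)⟩
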